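/- Let $(W,S)$ be a finite Coxeter system of type $A_n$ ($n\ge 1$), $B_n$ ($n\ge 2$) or $D_n$ ($n\ge 3$), where $S=\{s_1,\dots,s_n\}$ is labelled so that the Coxeter graph is the path $s_1 - s_2 - \cdots - s_n$ in type $A_n$; the same path with the edge $s_1 - s_2$ labelled $4$ in type $B_n$; and in type $D_n$ the graph with the edges $s_1 - s_3$, $s_2 - s_3$ and $s_i - s_{i+1}$ for $3\le i<n$. Let $\ell$ be the length function of $(W,S)$. For $J\subseteq S$ let $W_J$ be the subgroup generated by $J$, let $X_J=\{w\in W : \ell(ws)>\ell(w)\text{ for all } s\in J\}$, and let $x_J=\sum_{w\in X_J} w\in\mathbb{Q}W$; the elements $x_J$, $J\subseteq S$, form the standard basis of the descent algebra $\Sigma(W)$. For $0\le j\le n$ put $W_j=W_J$ and $x_j=x_J$ with $J=\{s_1,\dots,s_j\}$, except that in type $D_n$ we put $W_1=W_\emptyset$ and $x_1=x_\emptyset$. A subgroup of $W$ is called left-connected if it equals $W_j$ for some $0\le j\le n$ (with $j\ge 1$ in type $D_n$). A basis of a subalgebra of $\Sigma(W)$ is called native if it is a subset of $\{x_J : J\subseteq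 S\}$. Theorem. The subalgebra $\mathfrak{E}(W)=\mathbb{Q}[x_{n-1}]$ of $\mathbb{Q}W$ generated by $x_{n-1}$ has a native basis, namely the set of all $x_J$, $J\subseteq S$, for which $W_J$ is left-connected; these $x_J$ are pairwise distinct. Moreover, every element of this native basis is of the form $p(x_{n-1})$ for some polynomial $p$ with integer coefficients. -/

import Mathlib

/-- The three infinite families of classical finite Coxeter groups. -/
inductive ClassicalType where
  | A
  | B
  | D

namespace ClassicalType

/-- The ranks under consideration: `A_n` for `n ≥ 1`, `B_n` for `n ≥ 2`, `D_n` for `n ≥ 3`. -/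
def minRank : ClassicalType → ℕ
  | A => 1
  | B => 2
  | D => 3

/-- The Coxeter matrix of type `D_n` (`n ≥ 3`), with the two end nodes of the fork listed first:
nodes `0` and `1` are joined to node `2` but not to each other, and `2 — 3 — ⋯ — (n-1)` is a path.
(Mathlib's `CoxeterMatrix.D` also joins the two end nodes of the fork to each other, so it is not
used here.) -/
def matrixD (n : ℕ) : CoxeterMatrix (Fin n) where
  M := Matrix.of fun i j : Fin n ↦
    if i = j then 1
    else if ((i : ℕ) = 0 ∧ (j : ℕ) = 2) ∨ ((j : ℕ) = 0 ∧ (i : ℕ) = 2)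
        ∨ (1 ≤ (i : ℕ) ∧ (i : ℕ) + 1 = j) ∨ (1 ≤ (j : ℕ) ∧ (j : ℕ) + 1 = i) then 3
    else 2
  isSymm := by
    ext i j
    simp only [Matrix.transpose_apply, Matrix.of_apply]
    grind
  diagonal := by simp
  off_diagonal := by
    intro i j h
    simp only [Matrix.of_apply]
    grind

/-- The Coxeter matrix of type `A_n`, `B_n` or `D_n`. The index `i : Fin n` stands for the generator
`s_{i+1}` in the labelling
* `A_n`: `s_1 — s_2 — ⋯ — s_n`,
* `B_n`: `s_1 — s_2 — ⋯ — s_n`, where the edge `s_1 — s_2` has label `4`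
  (Mathlib's `CoxeterMatrix.B` has that edge at the other end, whence the reversal),
* `D_n`: `s_1 — s_3`, `s_2 — s_3`, and `s_3 — s_4 — ⋯ — s_n`. -/
def coxeterMatrix (T : ClassicalType) (n : ℕ) : CoxeterMatrix (Fin n) :=
  match T with
  | A => CoxeterMatrix.A n
  | B => (CoxeterMatrix.B n).reindex Fin.revPerm
  | D => matrixD n

/-- The set `{s_1, …, s_j}` of the first `j` generators (as a set of indices), except that for
type `D` and `j = 1` it is replaced by the empty set. -/
def initialSet (T : ClassicalType) (n j : ℕ) : Set (Fin n) :=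
  match T, j with
  | D, 1 => ∅
  | _, j => {i : Fin n | (i : ℕ) < j}

end ClassicalType

namespace CoxeterSystem

/-- The parabolic subgroup `W_J` generated by the simple reflections `s_i`, `i ∈ J`. -/
def parabolic {ι W : Type*} [Group W] {M : CoxeterMatrix ι} (cs : CoxeterSystem M W)
    (J : Set ι) : Subgroup W :=
  Subgroup.closure (cs.simple '' J)

/-- `X_J = {w ∈ W | ℓ(w s) > ℓ(w) for all s ∈ J}`, the set of distinguished representatives of the
left cosets `w W_J`. -/
def minReps {ι W : Type*} [Group W] {M : CoxeterMatrix ι} (cs : CoxeterSystem M W)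
    (J : Set ι) : Set W :=
  {w | ∀ i ∈ J, cs.length w < cs.length (w * cs.simple i)}

open Classical in
/-- `x_J`, the sum of the elements of `X_J` in the group algebra `ℚW` of a finite Coxeter group.
The `x_J`, for `J ⊆ S`, are the standard basis of the descent algebra of `W`. -/
noncomputable def descentElt {ι W : Type*} [Group W] [Fintype W] {M : CoxeterMatrix ι}
    (cs : CoxeterSystem M W) (J : Set ι) : MonoidAlgebra ℚ W :=
  ∑ w : W with w ∈ cs.minReps J, MonoidAlgebra.of ℚ W w

/-- `b` is a native basis of the subalgebra `E` of `ℚW`: it is a `ℚ`-linear basis of `E` and a subset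
of the standard basis `{x_J | J ⊆ S}` of the descent algebra
(so `E` is automatically contained in the descent algebra, the span of all `x_J`). -/
def IsNativeBasis {ι W : Type*} [Group W] [Fintype W] {M : CoxeterMatrix ι}
    (cs : CoxeterSystem M W) (E : Subalgebra ℚ (MonoidAlgebra ℚ W))
    (b : Set (MonoidAlgebra ℚ W)) : Prop :=
  b ⊆ Set.range cs.descentElt ∧ LinearIndepOn ℚ id b ∧
    Submodule.span ℚ b = Subalgebra.toSubmodule E

end CoxeterSystem

namespace ClassicalType

/-- A subgroup of `W` is left-connected if it is `W_j`, the parabolic subgroup of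
`{s_1, …, s_j}`, for some `0 ≤ j ≤ n`; for type `D`, `j ≥ 1` is required and `W_1` is trivial. -/
def IsLeftConnected {W : Type*} [Group W] (T : ClassicalType) (n : ℕ)
    (cs : CoxeterSystem (T.coxeterMatrix n) W) (U : Subgroup W) : Prop :=
  ∃ j ≤ n, (T = D → 1 ≤ j) ∧ U = cs.parabolic (T.initialSet n j)

/-- The element `x_j`, for the first `j` generators. -/
noncomputable def xElt {W : Type*} [Group W] [Fintype W] (T : ClassicalType) (n : ℕ)
    (cs : CoxeterSystem (T.coxeterMatrix n) W) (j : ℕ) : MonoidAlgebra ℚ W :=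
  cs.descentElt (T.initialSet n j)

/-- The algebra `𝔈(W) = ℚ[x_{n-1}]`. -/
noncomputable def algE {W : Type*} [Group W] [Fintype W] (T : ClassicalType) (n : ℕ)
    (cs : CoxeterSystem (T.coxeterMatrix n) W) : Subalgebra ℚ (MonoidAlgebra ℚ W) :=
  Algebra.adjoin ℚ {T.xElt n cs (n - 1)}

end ClassicalType

/-! Let ∅ = K_0 ⊂ K_1 ⊂ … ⊂ K_N = S be the sets whose parabolic subgroups are the left-connected
ones, and let y_k be the sum of the minimal representatives of W_{K_k} in W_{K_{k+1}}. Then x_{K_j}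
= y_{N-1} ⋯ y_j. If u_k is the reflection added to K_{k+1}, the representatives obey y_{k+1} = 1 +
y_k u_k + z_{k+1} with z_{k+1} = u_k z_k u_k. Here z_k is 0 in type A and a single involution in
types B and D; put d = 0 or d = 1 accordingly.

As u_k commutes with W_{K_k}, right multiplication by it permutes the minimal representatives of
W_{K_k} in W_{K_{k+2}}, so y_{k+1} y_k u_k = y_{k+1} y_k (`LadderRelations.mul_mul_u`). Together
with y_k z_k = d y_k this gives y_{k+1}² = (d+1) y_{k+1} + y_{k+1} y_k (`LadderRelations.sq_eq`).
Induction along the product yields x_{N-1} x_{j+1} = c x_{j+1} + x_j with a natural number c, and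
x_{N-1} x_0 = c' x_0 (`ySum_mul_xSum`, `ySum_mul_xSum_zero`). Starting from x_N = 1, every x_j is
thus an integer polynomial in x_{N-1}, and the span of the x_j is stable under multiplication by
x_{N-1}. Independence is a triangularity argument.

The representatives are controlled by an action through signed permutations of ℤ: W_{K_k} fixes a
point p_k, which distinct representatives send to distinct values. This makes factorisations unique
(`factor_unique`), and additivity of lengths (`length_mul`) follows by rewriting words. -/

/-! ### The quadratic relation in an abstract ring -/

/-- The relations in a ring between the sums `y k` of coset representatives in a tower of
parabolic subgroups, up to height `n`. -/
structure LadderRelations {R : Type*} [Ring R] (d n : ℕ) (y z u : ℕ → R) : Prop where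
  sq : ∀ k, u k * u k = 1
  y_succ : ∀ k, k + 2 ≤ n → y (k + 1) = 1 + y k * u k + z (k + 1)
  z_succ : ∀ k, k + 2 ≤ n → z (k + 1) = u k * z k * u k
  u_comm_y : ∀ k, k + 3 ≤ n → Commute (u (k + 1)) (y k)
  u_comm_z : ∀ k, k + 3 ≤ n → Commute (u (k + 1)) (z k)
  u_comm_y_zero : ∀ k, k + 3 ≤ n → Commute (u (k + 1)) (y 0)
  u_comm_z_zero : ∀ k, k + 3 ≤ n → Commute (u (k + 1)) (z 0)
  u_comm_u : ∀ k j, k + 2 ≤ n → j + 2 ≤ k → Commute (u k) (u j)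
  braid : ∀ k, k + 3 ≤ n → u k * u (k + 1) * u k = u (k + 1) * u k * u (k + 1)
  z_mul_z : z 0 * z 0 = d
  d_mul_z : d * z 0 = z 0
  y_mul_z : y 0 * z 0 = d * y 0
  z_comm_y : 2 ≤ n → Commute (z 1) (y 0)
  z_comm_z : 2 ≤ n → Commute (z 1) (z 0)
  base : 2 ≤ n → y 0 * u 0 * (y 0 - 1 - z 0) * u 0 = y 0 * u 0 * (y 0 - 1 - z 0)

namespace LadderRelations

variable {R : Type*} [Ring R] {d n : ℕ} {y z u : ℕ → R}

/-- Both identities survive conjugation by `u k` because `d` is central. In the application `d` is 0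
with `z = 0`, or 1 with `z` an involution; the identity `d * z k = z k` treats the two cases
uniformly. -/
theorem z_mul_z' (h : LadderRelations d n y z u) (k : ℕ) (hk : k + 1 ≤ n) :
    z k * z k = d ∧ d * z k = z k := by
  induction k with
  | zero => exact ⟨h.z_mul_z, h.d_mul_z⟩
  | succ k ih =>
    obtain ⟨h1, h2⟩ := ih (by omega)
    rw [h.z_succ k hk]
    have c := Nat.cast_commute d (u k)
    constructor
    · calc u k * z k * u k * (u k * z k * u k) = u k * z k * (u k * u k) * z k * u k := by
            noncomm_ring
        _ = u k * (z k * z k) * u k := by rw [h.sq]; noncomm_ring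
        _ = d := by rw [h1, ← c.eq, mul_assoc, h.sq, mul_one]
    · calc (d : R) * (u k * z k * u k) = (d * u k) * z k * u k := by noncomm_ring
        _ = u k * (d * z k) * u k := by rw [c.eq]; noncomm_ring
        _ = _ := by rw [h2]

theorem y_mul_z' (h : LadderRelations d n y z u) (k : ℕ) (hk : k + 1 ≤ n) :
    y k * z k = d * y k := by
  induction k with
  | zero => exact h.y_mul_z
  | succ k ih =>
    have ih := ih (by omega)
    obtain ⟨h1, h2⟩ := h.z_mul_z' (k + 1) hk
    have h3 : y k * u k * z (k + 1) = d * (y k * u k) := by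
      rw [h.z_succ k hk]
      calc y k * u k * (u k * z k * u k) = y k * (u k * u k) * z k * u k := by noncomm_ring
        _ = y k * z k * u k := by rw [h.sq, mul_one]
        _ = _ := by rw [ih, mul_assoc]
    rw [h.y_succ k hk, add_mul, add_mul, h1, h3, one_mul, mul_add, mul_add, h2, mul_one]
    abel

theorem z_comm_y_zero (h : LadderRelations d n y z u) (k : ℕ) (hk : k + 2 ≤ n) :
    Commute (z (k + 1)) (y 0) ∧ Commute (z (k + 1)) (z 0) := by
  induction k with
  | zero => exact ⟨h.z_comm_y hk, h.z_comm_z hk⟩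
  | succ k ih =>
    obtain ⟨h1, h2⟩ := ih (by omega)
    have a := h.u_comm_y_zero k hk
    have b := h.u_comm_z_zero k hk
    rw [h.z_succ (k + 1) hk]
    exact ⟨(a.mul_left h1).mul_left a, (b.mul_left h2).mul_left b⟩

/-- Written out, `z (k + 2)` is `z k` conjugated by `u (k + 1) * u k`. A braid relation turns `u k`
on the right into `u (k + 1)`, which passes through `z k`, and a second one turns it back into `u k`
on the left. -/
theorem z_comm_u_self (h : LadderRelations d n y z u) (k : ℕ) (hk : k + 3 ≤ n) :
    Commute (z (k + 2)) (u k) := by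
  have hb := h.braid k hk
  have hc := (h.u_comm_z k hk).eq
  rw [h.z_succ (k + 1) hk, h.z_succ k (by omega)]
  change _ = _
  calc u (k + 1) * (u k * z k * u k) * u (k + 1) * u k
      = u (k + 1) * u k * z k * (u k * u (k + 1) * u k) := by noncomm_ring
    _ = u (k + 1) * u k * (z k * u (k + 1)) * u k * u (k + 1) := by rw [hb]; noncomm_ring
    _ = (u (k + 1) * u k * u (k + 1)) * z k * u k * u (k + 1) := by rw [← hc]; noncomm_ring
    _ = _ := by rw [← hb]; noncomm_ring

theorem z_comm_u (h : LadderRelations d n y z u) (k : ℕ) (hk : k + 2 ≤ n) (j : ℕ) (hj : j < k) :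
    Commute (z (k + 1)) (u j) := by
  induction k with
  | zero => omega
  | succ k ih =>
    rcases Nat.lt_succ_iff_lt_or_eq.1 hj with hj | rfl
    · have a := h.u_comm_u (k + 1) j hk (by omega)
      rw [h.z_succ (k + 1) hk]
      exact (a.mul_left (ih (by omega) hj)).mul_left a
    · exact h.z_comm_u_self j hk

theorem z_comm_y' (h : LadderRelations d n y z u) (k : ℕ) (hk : k + 2 ≤ n) :
    Commute (z (k + 1)) (y k) := by
  have key : ∀ j ≤ k, Commute (z (k + 1)) (y j) ∧ Commute (z (k + 1)) (z j) := by
    intro j hj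
    induction j with
    | zero => exact h.z_comm_y_zero k hk
    | succ j ih =>
      obtain ⟨h1, h2⟩ := ih (by omega)
      have a := h.z_comm_u k hk j (by omega)
      have b : Commute (z (k + 1)) (z (j + 1)) := by
        rw [h.z_succ j (by omega)]
        exact (a.mul_right h2).mul_right a
      refine ⟨?_, b⟩
      rw [h.y_succ j (by omega)]
      exact ((Commute.one_right _).add_right (h1.mul_right a)).add_right b
  exact (key k le_rfl).1

/-- With `e = y k - 1 - z k`, the product `y (k + 1) * y k` expands into five terms. Right
multiplication by `u k` exchanges `y k` with `y k * u k` and `y k * z (k + 1)` with `y k * z (k + 1)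
* u k`, and it fixes `y k * u k * e` by hypothesis. -/
theorem mul_mul_u_of (h : LadderRelations d n y z u) (k : ℕ) (hk : k + 2 ≤ n)
    (he : y k * u k * (y k - 1 - z k) * u k = y k * u k * (y k - 1 - z k)) :
    y (k + 1) * y k * u k = y (k + 1) * y k := by
  have hz := (h.z_comm_y' k hk).eq
  have hs := h.sq k
  set e := y k - 1 - z k with he'
  have hy : y k = 1 + z k + e := by rw [he']; abel
  have h1 : y k * u k * z k = y k * z (k + 1) * u k := by
    rw [h.z_succ k hk]
    simp only [mul_assoc, hs, mul_one]
  have h2 : y k * u k * y k = y k * u k + y k * z (k + 1) * u k + y k * u k * e := by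
    rw [← h1]
    conv_lhs => rw [mul_assoc, hy]
    conv_rhs => rw [hy]
    noncomm_ring
  have h3 : y (k + 1) * y k
      = y k + (y k * u k + y k * z (k + 1) * u k + y k * u k * e) + y k * z (k + 1) := by
    rw [← h2, ← hz]
    conv_lhs => rw [h.y_succ k hk]
    noncomm_ring
  rw [h3]
  simp only [add_mul, he]
  simp only [mul_assoc, hs, mul_one]
  abel

theorem mul_mul_u (h : LadderRelations d n y z u) (k : ℕ) (hk : k + 2 ≤ n) :
    y (k + 1) * y k * u k = y (k + 1) * y k := by
  induction k with
  | zero => exact h.mul_mul_u_of 0 hk (h.base hk)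
  | succ k ih =>
    have ih := ih (by omega)
    refine h.mul_mul_u_of (k + 1) hk ?_
    -- Now the middle part is `y k * u k`; commutation and the braid relation reduce the required
    -- invariance under `u (k + 1)` to the induction hypothesis for `u k`.
    have e : y (k + 1) - 1 - z (k + 1) = y k * u k := by
      conv_lhs => rw [h.y_succ k (by omega)]
      abel
    have hc := (h.u_comm_y k hk).eq
    have key : y (k + 1) * u (k + 1) * (y k * u k) = y (k + 1) * y k * u (k + 1) * u k := by
      calc _ = y (k + 1) * (u (k + 1) * y k) * u k := by noncomm_ring
        _ = _ := by rw [hc]; noncomm_ring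
    rw [e, key]
    calc y (k + 1) * y k * u (k + 1) * u k * u (k + 1)
        = y (k + 1) * y k * (u (k + 1) * u k * u (k + 1)) := by noncomm_ring
      _ = y (k + 1) * y k * u k * u (k + 1) * u k := by rw [← h.braid k hk]; noncomm_ring
      _ = _ := by rw [ih]

/-- The quadratic relation between consecutive sums of coset representatives. -/
theorem sq_eq (h : LadderRelations d n y z u) (k : ℕ) (hk : k + 2 ≤ n) :
    y (k + 1) * y (k + 1) = (d + 1) * y (k + 1) + y (k + 1) * y k := by
  have h1 := h.mul_mul_u k hk
  have h2 := h.y_mul_z' (k + 1) hk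
  calc y (k + 1) * y (k + 1) = y (k + 1) * (1 + y k * u k + z (k + 1)) := by
        rw [← h.y_succ k hk]
    _ = y (k + 1) + y (k + 1) * y k * u k + y (k + 1) * z (k + 1) := by noncomm_ring
    _ = _ := by rw [h1, h2]; noncomm_ring

end LadderRelations

/-! ### Towers of parabolic subgroups: coset representatives and lengths -/

namespace CoxeterSystem

variable {ι W : Type*} [Group W] {M : CoxeterMatrix ι}

/-- A tower `K 0 = ∅, K 1, …, K N = S` of sets of simple reflections, each obtained from the
previous one (from `K 2` on) by adding one simple reflection `t k`, together with an action of the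
group by signed permutations of the integers in which `p k` is fixed by the parabolic subgroup of
`K k`. The initial data `Y₀` and `Z₀` are the parabolic subgroup of `K 1` and its part that
maps `p 0` to `-p 0`. -/
structure Ladder (cs : CoxeterSystem M W) (N : ℕ) where
  K : ℕ → Set ι
  t : ℕ → ι
  Y₀ : Finset W
  Z₀ : Finset W
  φ : W →* Function.End ℤ
  p : ℕ → ℤ
  one_le : 1 ≤ N
  K_zero : K 0 = ∅
  K_top : K N = Set.univ
  K_succ : ∀ k, k + 2 ≤ N → K (k + 2) = insert (t k) (K (k + 1))
  comm : ∀ k, k + 2 ≤ N → ∀ i ∈ K k, Commute (cs.simple i) (cs.simple (t k))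
  braid : ∀ k, k + 3 ≤ N →
    cs.simple (t k) * cs.simple (t (k + 1)) * cs.simple (t k) =
      cs.simple (t (k + 1)) * cs.simple (t k) * cs.simple (t (k + 1))
  one_mem_Y₀ : 1 ∈ Y₀
  Y₀_subset : ∀ y ∈ Y₀, y ∈ cs.parabolic (K 1)
  Y₀_ne : ∃ y ∈ Y₀, y ≠ 1
  Y₀_closed : ∀ i ∈ K 1, ∀ y ∈ Y₀, cs.simple i * y ∈ Y₀
  Z₀_subset : Z₀ ⊆ Y₀
  Z₀_subsingleton : ∀ z ∈ Z₀, ∀ z' ∈ Z₀, z = z'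
  Z₀_sq : ∀ z ∈ Z₀, z * z = 1
  Y₀_step : 2 ≤ N → ∀ y ∈ Y₀, y = 1 ∨ y ∈ Z₀ ∨ ∃ i ∈ K 1, y = cs.simple i ∧
    cs.simple (t 0) * y * cs.simple (t 0) = y * cs.simple (t 0) * y
  Z₀_step : 2 ≤ N → ∀ z ∈ Z₀, ∀ i ∈ K 1, ∃ i' ∈ K 1,
    cs.simple i * (cs.simple (t 0) * z * cs.simple (t 0)) =
      cs.simple (t 0) * z * cs.simple (t 0) * cs.simple i'
  Z₀_comm : 2 ≤ N → ∀ z ∈ Z₀, Commute (cs.simple (t 0) * z * cs.simple (t 0)) z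
  p_pos : 0 < p 0
  p_lt : ∀ k, p k < p (k + 1)
  p_fixed : ∀ k, k + 1 ≤ N → ∀ i ∈ K k, φ (cs.simple i) (p k) = p k
  p_succ : ∀ k, k + 2 ≤ N → φ (cs.simple (t k)) (p (k + 1)) = p k
  p_neg : ∀ k, k + 2 ≤ N → φ (cs.simple (t k)) (-p k) = -p (k + 1)
  Y₀_inj : ∀ y ∈ Y₀, ∀ y' ∈ Y₀, φ y (p 0) = φ y' (p 0) → y = y'
  Y₀_le : ∀ y ∈ Y₀, |φ y (p 0)| ≤ p 0
  Z₀_neg : ∀ z ∈ Z₀, φ z (p 0) = -p 0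

theorem simple_mem_parabolic (cs : CoxeterSystem M W) {J : Set ι} {i : ι} (hi : i ∈ J) :
    cs.simple i ∈ cs.parabolic J :=
  Subgroup.subset_closure (Set.mem_image_of_mem _ hi)

theorem parabolic_mono (cs : CoxeterSystem M W) {J J' : Set ι} (h : J ⊆ J') :
    cs.parabolic J ≤ cs.parabolic J' :=
  Subgroup.closure_mono (Set.image_mono h)

theorem wordProd_mem_parabolic (cs : CoxeterSystem M W) {J : Set ι} {ω : List ι}
    (h : ∀ i ∈ ω, i ∈ J) : cs.wordProd ω ∈ cs.parabolic J := by
  refine Subgroup.list_prod_mem _ fun x hx ↦ ?_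
  obtain ⟨i, hi, rfl⟩ := List.mem_map.1 hx
  exact cs.simple_mem_parabolic (h i hi)

theorem exists_word_of_mem_parabolic (cs : CoxeterSystem M W) {J : Set ι} {w : W}
    (hw : w ∈ cs.parabolic J) : ∃ ω : List ι, (∀ i ∈ ω, i ∈ J) ∧ cs.wordProd ω = w := by
  induction hw using Subgroup.closure_induction with
  | mem x hx =>
    obtain ⟨i, hi, rfl⟩ := hx
    exact ⟨[i], by simpa using hi, by simp⟩
  | one => exact ⟨[], by simp, by simp⟩
  | mul x y _ _ hx hy =>
    obtain ⟨ω, h1, rfl⟩ := hx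
    obtain ⟨ω', h2, rfl⟩ := hy
    refine ⟨ω ++ ω', fun i hi ↦ ?_, cs.wordProd_append _ _⟩
    rcases List.mem_append.1 hi with hi | hi
    exacts [h1 i hi, h2 i hi]
  | inv x _ hx =>
    obtain ⟨ω, h1, rfl⟩ := hx
    exact ⟨ω.reverse, fun i hi ↦ h1 i (List.mem_reverse.1 hi), cs.wordProd_reverse _⟩

namespace Ladder

variable {cs : CoxeterSystem M W} {N : ℕ} (L : Ladder cs N)

/-- The simple reflection added in passing from `K (k + 1)` to `K (k + 2)`. -/
def u (k : ℕ) : W := cs.simple (L.t k)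

@[simp] theorem u_mul_u (k : ℕ) : L.u k * L.u k = 1 := cs.simple_mul_simple_self _

@[simp] theorem u_mul_u_mul (k : ℕ) (w : W) : L.u k * (L.u k * w) = w :=
  cs.simple_mul_simple_cancel_left _

open Classical in
/-- The set of the coset representatives of `K k` in `K (k + 1)` that map `p k` to `-p k`. -/
noncomputable def Z : ℕ → Finset W
  | 0 => L.Z₀
  | k + 1 => (Z k).image fun z ↦ L.u k * z * L.u k

open Classical in
/-- The set of minimal left coset representatives of the parabolic subgroup of `K k` in that of
`K (k + 1)`. -/
noncomputable def Y : ℕ → Finset W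
  | 0 => L.Y₀
  | k + 1 => insert 1 ((Y k).image (· * L.u k) ∪ L.Z (k + 1))

theorem mem_Z_succ {k : ℕ} {w : W} : w ∈ L.Z (k + 1) ↔ ∃ z ∈ L.Z k, L.u k * z * L.u k = w := by
  simp [Z]

theorem mem_Y_succ {k : ℕ} {w : W} :
    w ∈ L.Y (k + 1) ↔ w = 1 ∨ (∃ y ∈ L.Y k, y * L.u k = w) ∨ w ∈ L.Z (k + 1) := by
  simp only [Y, Finset.mem_insert, Finset.mem_union, Finset.mem_image]

theorem one_mem_Y (k : ℕ) : 1 ∈ L.Y k := by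
  cases k with
  | zero => exact L.one_mem_Y₀
  | succ k => exact L.mem_Y_succ.2 (.inl rfl)

theorem Z_subset_Y (k : ℕ) : L.Z k ⊆ L.Y k := by
  cases k with
  | zero => exact L.Z₀_subset
  | succ k => exact fun z hz ↦ L.mem_Y_succ.2 (.inr (.inr hz))

theorem K_subset_succ (k : ℕ) (hk : k + 1 ≤ N) : L.K k ⊆ L.K (k + 1) := by
  cases k with
  | zero => simp [L.K_zero]
  | succ k => rw [L.K_succ k hk]; exact Set.subset_insert _ _

theorem K_mono {j k : ℕ} (h : j ≤ k) (hk : k ≤ N) : L.K j ⊆ L.K k := by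
  induction k, h using Nat.le_induction with
  | base => exact subset_rfl
  | succ k _ ih => exact (ih (by omega)).trans (L.K_subset_succ k hk)

theorem u_mem (k : ℕ) (hk : k + 2 ≤ N) : L.u k ∈ cs.parabolic (L.K (k + 2)) := by
  rw [L.K_succ k hk]
  exact cs.simple_mem_parabolic (Set.mem_insert _ _)

theorem Y_subset_parabolic (k : ℕ) (hk : k + 1 ≤ N) {y : W} (hy : y ∈ L.Y k) :
    y ∈ cs.parabolic (L.K (k + 1)) := by
  induction k generalizing y with
  | zero => exact L.Y₀_subset y hy
  | succ k ih =>
    have hu := L.u_mem k hk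
    have h : ∀ {y}, y ∈ L.Y k → y ∈ cs.parabolic (L.K (k + 2)) := fun hy ↦
      cs.parabolic_mono (L.K_subset_succ (k + 1) hk) (ih (by omega) hy)
    rw [L.mem_Y_succ] at hy
    rcases hy with rfl | ⟨y, hy, rfl⟩ | hz
    · exact one_mem _
    · exact mul_mem (h hy) hu
    · rw [L.mem_Z_succ] at hz
      obtain ⟨z, hz, rfl⟩ := hz
      exact mul_mem (mul_mem hu (h (L.Z_subset_Y k hz))) hu

theorem u_commute (k : ℕ) (hk : k + 2 ≤ N) {w : W} (hw : w ∈ cs.parabolic (L.K k)) :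
    Commute (L.u k) w := by
  induction hw using Subgroup.closure_induction with
  | mem x hx =>
    obtain ⟨i, hi, rfl⟩ := hx
    exact (L.comm k hk i hi).symm
  | one => exact Commute.one_right _
  | mul x y _ _ hx hy => exact hx.mul_right hy
  | inv x _ hx => exact hx.inv_right

theorem u_commute_Y (k : ℕ) (hk : k + 3 ≤ N) {y : W} (hy : y ∈ L.Y k) :
    Commute (L.u (k + 1)) y :=
  L.u_commute (k + 1) hk (L.Y_subset_parabolic k (by omega) hy)

theorem u_braid (k : ℕ) (hk : k + 3 ≤ N) :
    L.u k * L.u (k + 1) * L.u k = L.u (k + 1) * L.u k * L.u (k + 1) := L.braid k hk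

theorem Z_step (k : ℕ) (hk : k + 2 ≤ N) {z : W} (hz : z ∈ L.Z (k + 1)) {i : ι}
    (hi : i ∈ L.K (k + 1)) : ∃ i' ∈ L.K (k + 1), cs.simple i * z = z * cs.simple i' := by
  induction k generalizing z i with
  | zero =>
    rw [L.mem_Z_succ] at hz
    obtain ⟨z, hz, rfl⟩ := hz
    exact L.Z₀_step hk z hz i hi
  | succ k ih =>
    rw [L.mem_Z_succ] at hz
    obtain ⟨z', hz', rfl⟩ := hz
    rw [L.K_succ k (by omega)] at hi
    rcases hi with rfl | hi
    · refine ⟨L.t k, by rw [L.K_succ k (by omega)]; exact Set.mem_insert _ _, ?_⟩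
      rw [L.mem_Z_succ] at hz'
      obtain ⟨z, hz, rfl⟩ := hz'
      have hb := L.u_braid k hk
      have hc := (L.u_commute_Y k hk (L.Z_subset_Y k hz)).eq
      change L.u k * _ = _ * L.u k
      calc L.u k * (L.u (k + 1) * (L.u k * z * L.u k) * L.u (k + 1))
          = (L.u k * L.u (k + 1) * L.u k) * z * L.u k * L.u (k + 1) := by
            simp only [mul_assoc]
        _ = L.u (k + 1) * L.u k * (L.u (k + 1) * z) * L.u k * L.u (k + 1) := by
            rw [hb]; simp only [mul_assoc]
        _ = L.u (k + 1) * L.u k * z * (L.u (k + 1) * L.u k * L.u (k + 1)) := by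
            rw [hc]; simp only [mul_assoc]
        _ = _ := by rw [← hb]; simp only [mul_assoc]
    · obtain ⟨i', hi', e⟩ := ih (by omega) hz' hi
      refine ⟨i', L.K_subset_succ (k + 1) (by omega) hi', ?_⟩
      have c1 : Commute (cs.simple i) (L.u (k + 1)) := L.comm (k + 1) hk i hi
      have c2 : Commute (cs.simple i') (L.u (k + 1)) := L.comm (k + 1) hk i' hi'
      calc cs.simple i * (L.u (k + 1) * z' * L.u (k + 1))
          = (cs.simple i * L.u (k + 1)) * z' * L.u (k + 1) := by simp only [mul_assoc]
        _ = L.u (k + 1) * (cs.simple i * z') * L.u (k + 1) := by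
            rw [c1.eq]; simp only [mul_assoc]
        _ = L.u (k + 1) * z' * (cs.simple i' * L.u (k + 1)) := by
            rw [e]; simp only [mul_assoc]
        _ = _ := by rw [c2.eq]; simp only [mul_assoc]

/-- This is the action of the newest reflection on the middle part `Y k * u k` of `Y (k + 1)`. For a
representative ending in the previous reflection, the braid relation trades the left factor for a
simple reflection on the right. -/
theorem u_conj_Y (k : ℕ) (hk : k + 2 ≤ N) {y : W} (hy : y ∈ L.Y k) :
    L.u k * y * L.u k ∈ L.Y (k + 1) ∨
      ∃ i ∈ L.K (k + 1), L.u k * y * L.u k = y * L.u k * cs.simple i := by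
  have h1 : L.u k * 1 * L.u k ∈ L.Y (k + 1) := by simpa using L.one_mem_Y _
  have hz : y ∈ L.Z k → L.u k * y * L.u k ∈ L.Y (k + 1) := fun hz ↦
    L.Z_subset_Y _ (L.mem_Z_succ.2 ⟨y, hz, rfl⟩)
  cases k with
  | zero =>
    rcases L.Y₀_step hk y hy with rfl | h | ⟨i, hi, rfl, h⟩
    exacts [.inl h1, .inl (hz h), .inr ⟨i, hi, h⟩]
  | succ k =>
    rw [L.mem_Y_succ] at hy
    rcases hy with rfl | ⟨y, hy, rfl⟩ | h
    · exact .inl h1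
    · refine .inr ⟨L.t k, by rw [L.K_succ k (by omega)]; exact Set.mem_insert _ _, ?_⟩
      have hc := (L.u_commute_Y k hk hy).eq
      change _ = _ * L.u k
      calc L.u (k + 1) * (y * L.u k) * L.u (k + 1)
          = L.u (k + 1) * y * L.u k * L.u (k + 1) := by simp only [mul_assoc]
        _ = y * (L.u (k + 1) * L.u k * L.u (k + 1)) := by rw [hc]; simp only [mul_assoc]
        _ = _ := by rw [← L.u_braid k hk]; simp only [mul_assoc]
    · exact .inl (hz h)

/-- Deodhar's dichotomy for minimal representatives, here derived from the recursion for `Y`: a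
letter meeting a representative either changes it or passes through it as a single letter of `K k`.
-/
theorem Y_closed (k : ℕ) (hk : k + 1 ≤ N) {y : W} (hy : y ∈ L.Y k) {i : ι}
    (hi : i ∈ L.K (k + 1)) :
    cs.simple i * y ∈ L.Y k ∨ ∃ i' ∈ L.K k, cs.simple i * y = y * cs.simple i' := by
  induction k generalizing y i with
  | zero => exact .inl (L.Y₀_closed i hi y hy)
  | succ k ih =>
    rw [L.K_succ k hk] at hi
    rcases hi with rfl | hi
    · change L.u k * y ∈ _ ∨ _
      rw [L.mem_Y_succ] at hy
      rcases hy with rfl | ⟨y, hy, rfl⟩ | hz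
      · exact .inl (L.mem_Y_succ.2 (.inr (.inl ⟨1, L.one_mem_Y k, by simp⟩)))
      · simpa only [u, mul_assoc] using L.u_conj_Y k hk hy
      · rw [L.mem_Z_succ] at hz
        obtain ⟨z, hz, rfl⟩ := hz
        exact .inl (L.mem_Y_succ.2 (.inr (.inl ⟨z, L.Z_subset_Y k hz, by simp [mul_assoc]⟩)))
    · rw [L.mem_Y_succ] at hy
      rcases hy with rfl | ⟨y, hy, rfl⟩ | hz
      · exact .inr ⟨i, hi, by simp⟩
      · rcases ih (by omega) hy hi with h | ⟨i', hi', h⟩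
        · exact .inl (L.mem_Y_succ.2 (.inr (.inl ⟨_, h, mul_assoc _ _ _⟩)))
        · refine .inr ⟨i', L.K_subset_succ k (by omega) hi', ?_⟩
          have hc : Commute (cs.simple i') (L.u k) := L.comm k hk i' hi'
          rw [← mul_assoc, h, mul_assoc, hc.eq, mul_assoc]
      · exact .inr (L.Z_step k hk hz hi)

theorem p_pos' (k : ℕ) : 0 < L.p k := by
  induction k with
  | zero => exact L.p_pos
  | succ k ih => exact ih.trans (L.p_lt k)

theorem φ_mul (v w : W) (x : ℤ) : L.φ (v * w) x = L.φ v (L.φ w x) := by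
  rw [map_mul]; rfl

theorem φ_fixed (k : ℕ) (hk : k + 1 ≤ N) {w : W} (hw : w ∈ cs.parabolic (L.K k)) :
    L.φ w (L.p k) = L.p k := by
  induction hw using Subgroup.closure_induction with
  | mem x hx =>
    obtain ⟨i, hi, rfl⟩ := hx
    exact L.p_fixed k hk i hi
  | one => rw [map_one]; rfl
  | mul x y _ _ hx hy => rw [L.φ_mul, hy, hx]
  | inv x _ hx =>
    conv_lhs => rw [← hx]
    rw [← L.φ_mul, inv_mul_cancel, map_one]; rfl

theorem Z_subsingleton (k : ℕ) {z z' : W} (hz : z ∈ L.Z k) (hz' : z' ∈ L.Z k) : z = z' := by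
  induction k generalizing z z' with
  | zero => exact L.Z₀_subsingleton z hz z' hz'
  | succ k ih =>
    rw [L.mem_Z_succ] at hz
    obtain ⟨z, hz, rfl⟩ := hz
    rw [L.mem_Z_succ] at hz'
    obtain ⟨z', hz', rfl⟩ := hz'
    rw [ih hz hz']

theorem Z_neg (k : ℕ) (hk : k + 1 ≤ N) {z : W} (hz : z ∈ L.Z k) : L.φ z (L.p k) = -L.p k := by
  induction k generalizing z with
  | zero => exact L.Z₀_neg z hz
  | succ k ih =>
    rw [L.mem_Z_succ] at hz
    obtain ⟨z, hz, rfl⟩ := hz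
    rw [L.φ_mul, L.φ_mul, u, L.p_succ k hk, ih (by omega) hz, L.p_neg k hk]

theorem φ_mul_u (k : ℕ) (hk : k + 2 ≤ N) (y : W) :
    L.φ (y * L.u k) (L.p (k + 1)) = L.φ y (L.p k) := by
  rw [L.φ_mul, u, L.p_succ k hk]

theorem φ_one (x : ℤ) : L.φ 1 x = x := by rw [map_one]; rfl

theorem Y_le (k : ℕ) (hk : k + 1 ≤ N) {y : W} (hy : y ∈ L.Y k) : |L.φ y (L.p k)| ≤ L.p k := by
  induction k generalizing y with
  | zero => exact L.Y₀_le y hy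
  | succ k ih =>
    have hp := (L.p_pos' (k + 1)).le
    rw [L.mem_Y_succ] at hy
    rcases hy with rfl | ⟨y, hy, rfl⟩ | hz
    · rw [L.φ_one, abs_of_nonneg hp]
    · rw [L.φ_mul_u k hk]
      exact (ih (by omega) hy).trans (L.p_lt k).le
    · rw [L.Z_neg _ hk hz, abs_neg, abs_of_nonneg hp]

/-- The three parts of `Y (k + 1)` are told apart by the image of `p (k + 1)`: it is `p (k + 1)` for
the identity, `-p (k + 1)` on `Z (k + 1)`, and of absolute value at most `p k` on the middle part,
where induction applies. -/
theorem Y_inj (k : ℕ) (hk : k + 1 ≤ N) {y y' : W} (hy : y ∈ L.Y k) (hy' : y' ∈ L.Y k)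
    (h : L.φ y (L.p k) = L.φ y' (L.p k)) : y = y' := by
  induction k generalizing y y' with
  | zero => exact L.Y₀_inj y hy y' hy' h
  | succ k ih =>
    have hp := L.p_lt k
    have hp' := L.p_pos' (k + 1)
    have hle : ∀ {y}, y ∈ L.Y k → |L.φ (y * L.u k) (L.p (k + 1))| ≤ L.p k := fun hy ↦ by
      rw [L.φ_mul_u k hk]; exact L.Y_le k (by omega) hy
    rw [L.mem_Y_succ] at hy hy'
    rcases hy with rfl | ⟨y, hy, rfl⟩ | hz
    · rcases hy' with rfl | ⟨y', hy', rfl⟩ | hz'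
      · rfl
      · have := abs_le.1 (hle hy')
        rw [L.φ_one] at h; omega
      · rw [L.φ_one, L.Z_neg _ hk hz'] at h; omega
    · have := abs_le.1 (hle hy)
      rcases hy' with rfl | ⟨y', hy', rfl⟩ | hz'
      · rw [L.φ_one] at h; omega
      · rw [L.φ_mul_u k hk, L.φ_mul_u k hk] at h
        rw [ih (by omega) hy hy' h]
      · rw [L.Z_neg _ hk hz'] at h; omega
    · rcases hy' with rfl | ⟨y', hy', rfl⟩ | hz'
      · rw [L.φ_one, L.Z_neg _ hk hz] at h; omega
      · have := abs_le.1 (hle hy')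
        rw [L.Z_neg _ hk hz] at h; omega
      · exact L.Z_subsingleton _ hz hz'

/-- The right factor fixes `p k`, so the image of `p k` under the product already determines the
left factor. -/
theorem factor_unique (k : ℕ) (hk : k + 1 ≤ N) {y y' v v' : W} (hy : y ∈ L.Y k)
    (hy' : y' ∈ L.Y k) (hv : v ∈ cs.parabolic (L.K k)) (hv' : v' ∈ cs.parabolic (L.K k))
    (h : y * v = y' * v') : y = y' ∧ v = v' := by
  have h1 : y = y' := by
    refine L.Y_inj k hk hy hy' ?_
    calc L.φ y (L.p k) = L.φ (y * v) (L.p k) := by rw [L.φ_mul, L.φ_fixed k hk hv]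
      _ = L.φ y' (L.p k) := by rw [h, L.φ_mul, L.φ_fixed k hk hv']
  subst h1
  exact ⟨rfl, mul_left_cancel h⟩

/-- The letters are fed in from the right. By `Y_closed` each one lengthens the representative by at
most one or becomes one letter of the remaining word, so the total length never exceeds that of the
original word. -/
theorem factor_word (k : ℕ) (hk : k + 1 ≤ N) (ω : List ι) (hω : ∀ i ∈ ω, i ∈ L.K (k + 1)) :
    ∃ y ∈ L.Y k, ∃ ω' : List ι, (∀ i ∈ ω', i ∈ L.K k) ∧
      cs.wordProd ω = y * cs.wordProd ω' ∧ cs.length y + ω'.length ≤ ω.length := by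
  induction ω with
  | nil => exact ⟨1, L.one_mem_Y k, [], by simp, by simp, by simp⟩
  | cons i ω ih =>
    obtain ⟨y, hy, ω', h1, h2, h3⟩ := ih fun j hj ↦ hω j (List.mem_cons_of_mem _ hj)
    rcases L.Y_closed k hk hy (hω i List.mem_cons_self) with h | ⟨i', hi', h⟩
    · refine ⟨_, h, ω', h1, by rw [cs.wordProd_cons, h2, mul_assoc], ?_⟩
      have := cs.length_mul_le (cs.simple i) y
      rw [cs.length_simple] at this
      rw [List.length_cons]; omega
    · refine ⟨y, hy, i' :: ω', ?_, ?_, ?_⟩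
      · intro j hj
        rcases List.mem_cons.1 hj with rfl | hj
        exacts [hi', h1 j hj]
      · rw [cs.wordProd_cons, cs.wordProd_cons, h2, ← mul_assoc, h, mul_assoc]
      · simp only [List.length_cons]; omega

/-- Descending induction from `K N = S`, where every reduced word qualifies. -/
theorem exists_reduced_word (k : ℕ) (hk : k ≤ N) {w : W} (hw : w ∈ cs.parabolic (L.K k)) :
    ∃ ω : List ι, (∀ i ∈ ω, i ∈ L.K k) ∧ cs.wordProd ω = w ∧ ω.length = cs.length w := by
  induction hk using Nat.decreasingInduction generalizing w with
  | self =>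
    obtain ⟨ω, h1, h2⟩ := cs.exists_isReduced w
    exact ⟨ω, by simp [L.K_top], h2.symm, by rw [h2, h1.eq]⟩
  | of_succ k hk ih =>
    obtain ⟨ω, h1, h2, h3⟩ := ih (cs.parabolic_mono (L.K_subset_succ k hk) hw)
    obtain ⟨y, hy, ω', h4, h5, h6⟩ := L.factor_word k hk ω h1
    -- As `w` lies in the smaller subgroup, its representative is 1; the remaining word then spells
    -- `w` and is no longer than the reduced word `ω`.
    obtain ⟨rfl, h8⟩ := L.factor_unique k hk (L.one_mem_Y k) hy hw
      (cs.wordProd_mem_parabolic h4) (by rw [one_mul, ← h2, h5])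
    refine ⟨ω', h4, h8.symm, ?_⟩
    have := cs.length_wordProd_le ω'
    rw [← h8] at this
    omega

/-- Splitting a reduced word of `y * v` by `factor_word` must return `y` and `v`, by uniqueness, and
the split does not increase the length. -/
theorem length_mul (k : ℕ) (hk : k + 1 ≤ N) {y v : W} (hy : y ∈ L.Y k)
    (hv : v ∈ cs.parabolic (L.K k)) : cs.length (y * v) = cs.length y + cs.length v := by
  refine le_antisymm (cs.length_mul_le y v) ?_
  obtain ⟨ω, h1, h2, h3⟩ := L.exists_reduced_word (k + 1) hk (mul_mem
    (L.Y_subset_parabolic k hk hy) (cs.parabolic_mono (L.K_subset_succ k hk) hv))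
  obtain ⟨y', hy', ω', h4, h5, h6⟩ := L.factor_word k hk ω h1
  obtain ⟨rfl, rfl⟩ := L.factor_unique k hk hy hy' hv
      (cs.wordProd_mem_parabolic h4) (by rw [← h2, h5])
  have := cs.length_wordProd_le ω'
  omega

theorem exists_factor (k : ℕ) (hk : k + 1 ≤ N) {w : W} (hw : w ∈ cs.parabolic (L.K (k + 1))) :
    ∃ y ∈ L.Y k, ∃ v ∈ cs.parabolic (L.K k), w = y * v := by
  obtain ⟨ω, h1, rfl⟩ := cs.exists_word_of_mem_parabolic hw
  obtain ⟨y, hy, ω', h4, h5, -⟩ := L.factor_word k hk ω h1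
  exact ⟨y, hy, _, cs.wordProd_mem_parabolic h4, h5⟩

theorem mul_mem_minReps_iff (k : ℕ) (hk : k + 1 ≤ N) {y v : W} (hy : y ∈ L.Y k)
    (hv : v ∈ cs.parabolic (L.K k)) {j : ℕ} (hj : j ≤ k) :
    y * v ∈ cs.minReps (L.K j) ↔ v ∈ cs.minReps (L.K j) := by
  refine forall₂_congr fun i hi ↦ ?_
  have hi' := cs.simple_mem_parabolic (L.K_mono hj (by omega) hi)
  rw [mul_assoc, L.length_mul k hk hy hv, L.length_mul k hk hy (mul_mem hv hi')]
  omega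

/-- Otherwise the last letter of a reduced word with letters in `K k` would be a right descent. -/
theorem eq_one_of_mem_minReps (k : ℕ) (hk : k ≤ N) {w : W} (hw : w ∈ cs.parabolic (L.K k))
    (h : w ∈ cs.minReps (L.K k)) : w = 1 := by
  obtain ⟨ω, h1, h2, h3⟩ := L.exists_reduced_word k hk hw
  rcases ω.eq_nil_or_concat with rfl | ⟨ω, i, rfl⟩
  · simpa using h2.symm
  · have hi := h i (h1 i (by simp))
    rw [List.concat_eq_append] at h2 h3
    rw [← h2, cs.wordProd_append, cs.wordProd_singleton,
      cs.simple_mul_simple_cancel_right] at hi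
    have := cs.length_wordProd_le ω
    rw [← h2, cs.wordProd_append, cs.wordProd_singleton] at h3
    simp at h3
    omega

theorem one_mem_minReps (J : Set ι) : (1 : W) ∈ cs.minReps J := fun i _ ↦ by simp

end Ladder

end CoxeterSystem

/-! ### Sums of coset representatives in the group algebra -/

namespace CoxeterSystem

variable {ι W : Type*} [Group W] {M : CoxeterMatrix ι}

namespace Ladder

variable {cs : CoxeterSystem M W} {N : ℕ} (L : Ladder cs N)

local notation "a" => MonoidAlgebra.of ℚ W

/-- The sum of the coset representatives in `Y k`. -/
noncomputable def ySum (k : ℕ) : MonoidAlgebra ℚ W := ∑ y ∈ L.Y k, a y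

/-- The sum of the elements of `Z k`. -/
noncomputable def zSum (k : ℕ) : MonoidAlgebra ℚ W := ∑ z ∈ L.Z k, a z

/-- Since `K 0` is empty, the bottom set of representatives is a whole subgroup; hence its sum
absorbs each of its elements. -/
theorem mem_Y₀_iff {w : W} : w ∈ L.Y₀ ↔ w ∈ cs.parabolic (L.K 1) := by
  refine ⟨L.Y₀_subset w, fun hw ↦ ?_⟩
  obtain ⟨ω, h1, rfl⟩ := cs.exists_word_of_mem_parabolic hw
  clear hw
  induction ω with
  | nil => simpa using L.one_mem_Y₀
  | cons i ω ih =>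
    rw [cs.wordProd_cons]
    exact L.Y₀_closed i (h1 i List.mem_cons_self) _
      (ih fun j hj ↦ h1 j (List.mem_cons_of_mem _ hj))

theorem ySum_zero_mul {w : W} (hw : w ∈ L.Y₀) : L.ySum 0 * a w = L.ySum 0 := by
  rw [L.mem_Y₀_iff] at hw
  rw [ySum, Finset.sum_mul]
  refine Finset.sum_nbij' (· * w) (· * w⁻¹) (fun y hy ↦ ?_) (fun y hy ↦ ?_) (by simp) (by simp)
    (by simp)
  · exact L.mem_Y₀_iff.2 (mul_mem (L.mem_Y₀_iff.1 hy) hw)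
  · exact L.mem_Y₀_iff.2 (mul_mem (L.mem_Y₀_iff.1 hy) (inv_mem hw))

theorem ySum_zero_mul_ySum_zero :
    L.ySum 0 * L.ySum 0 = (L.Y₀.card : MonoidAlgebra ℚ W) * L.ySum 0 := by
  conv_lhs => rhs; rw [ySum, Y]
  rw [Finset.mul_sum, Finset.sum_congr rfl fun y hy ↦ L.ySum_zero_mul hy, Finset.sum_const,
    nsmul_eq_mul]

theorem ySum_succ (k : ℕ) (hk : k + 2 ≤ N) :
    L.ySum (k + 1) = 1 + L.ySum k * a (L.u k) + L.zSum (k + 1) := by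
  classical
  have hp := L.p_lt k
  have hp' := L.p_pos' (k + 1)
  have hle : ∀ y ∈ L.Y k, |L.φ (y * L.u k) (L.p (k + 1))| ≤ L.p k := fun y hy ↦ by
    rw [L.φ_mul_u k hk]; exact L.Y_le k (by omega) hy
  have e : L.Y (k + 1) = insert 1 ((L.Y k).image (· * L.u k) ∪ L.Z (k + 1)) := by
    ext; simp only [L.mem_Y_succ, Finset.mem_insert, Finset.mem_union, Finset.mem_image]
  rw [ySum, e, Finset.sum_insert, Finset.sum_union, Finset.sum_image, map_one, ySum, zSum,
    Finset.sum_mul, add_assoc]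
  · simp only [map_mul]
  · exact fun x _ y _ h ↦ mul_right_cancel h
  · rw [Finset.disjoint_left]
    intro w hw hz
    obtain ⟨y, hy, rfl⟩ := Finset.mem_image.1 hw
    have h1 := abs_le.1 (hle y hy)
    rw [L.Z_neg _ hk hz] at h1
    omega
  · intro h
    rcases Finset.mem_union.1 h with h | h
    · obtain ⟨y, hy, h⟩ := Finset.mem_image.1 h
      have h1 := abs_le.1 (hle y hy)
      rw [h, L.φ_one] at h1
      omega
    · have h1 := L.Z_neg _ hk h
      rw [L.φ_one] at h1
      omega

theorem zSum_succ (k : ℕ) : L.zSum (k + 1) = a (L.u k) * L.zSum k * a (L.u k) := by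
  classical
  have e : L.Z (k + 1) = (L.Z k).image fun z ↦ L.u k * z * L.u k := by
    ext; simp only [L.mem_Z_succ, Finset.mem_image]
  rw [zSum, e, Finset.sum_image, zSum, Finset.mul_sum, Finset.sum_mul]
  · simp only [map_mul]
  · exact fun x _ y _ h ↦ mul_left_cancel (mul_right_cancel h)

theorem exists_conj_mem_Y₀ (hN : 2 ≤ N) {z : W} (hz : z ∈ L.Z 1) {w : W} (hw : w ∈ L.Y₀) :
    z⁻¹ * w * z ∈ L.Y₀ := by
  rw [L.mem_Y₀_iff] at hw ⊢
  induction hw using Subgroup.closure_induction with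
  | mem x hx =>
    obtain ⟨i, hi, rfl⟩ := hx
    obtain ⟨i', hi', h⟩ := L.Z_step 0 hN hz hi
    rw [mul_assoc, h, inv_mul_cancel_left]
    exact cs.simple_mem_parabolic hi'
  | one => simp
  | mul x y _ _ hx hy => simpa [mul_assoc] using mul_mem hx hy
  | inv x _ hx => simpa [mul_assoc] using inv_mem hx

theorem Z_one_inv {z : W} (hz : z ∈ L.Z 1) : z⁻¹ = z := by
  rw [L.mem_Z_succ] at hz
  obtain ⟨z, hz, rfl⟩ := hz
  have h : z⁻¹ = z := inv_eq_of_mul_eq_one_left (L.Z₀_sq z hz)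
  have h' : (L.u 0)⁻¹ = L.u 0 := cs.inv_simple _
  simp [h, h', mul_assoc]

/-- Conjugation by the involution `z` permutes `Y₀`, because it permutes the generators in `K 1`. -/
theorem commute_ySum_zero (hN : 2 ≤ N) {z : W} (hz : z ∈ L.Z 1) :
    Commute (a z) (L.ySum 0) := by
  have hi := L.Z_one_inv hz
  have hz2 : z * z = 1 := by nth_rw 1 [← hi]; exact inv_mul_cancel z
  have hm : ∀ w ∈ L.Y₀, z * w * z ∈ L.Y₀ := fun w hw ↦ by
    simpa only [hi] using L.exists_conj_mem_Y₀ hN hz hw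
  have hc : ∀ w, z * (z * w * z) * z = w := fun w ↦ by
    rw [← mul_assoc, ← mul_assoc, hz2, one_mul, mul_assoc, hz2, mul_one]
  change _ = _
  rw [ySum, Finset.sum_mul, Finset.mul_sum]
  refine Finset.sum_nbij' (fun w ↦ z * w * z) (fun w ↦ z * w * z) hm hm (fun w _ ↦ hc w)
    (fun w _ ↦ hc w) fun w _ ↦ ?_
  rw [← map_mul, ← map_mul, mul_assoc (z * w), hz2, mul_one]

theorem Z₀_eq : L.Z₀ = ∅ ∨ ∃ z ∈ L.Y₀, z * z = 1 ∧ L.Z₀ = {z} := by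
  rcases L.Z₀.eq_empty_or_nonempty with h | ⟨z, hz⟩
  · exact .inl h
  · exact .inr ⟨z, L.Z₀_subset hz, L.Z₀_sq z hz,
      Finset.eq_singleton_iff_unique_mem.2 ⟨hz, fun y hy ↦ L.Z₀_subsingleton y hy z hz⟩⟩

/-- Each remaining `y` is a simple reflection braiding with `u 0`, so `u 0 * y * u 0 = y * u 0 * y`,
and the leftmost `y` is absorbed by the sum over the subgroup `Y₀`. -/
theorem relations_base (hN : 2 ≤ N) :
    L.ySum 0 * a (L.u 0) * (L.ySum 0 - 1 - L.zSum 0) * a (L.u 0) =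
      L.ySum 0 * a (L.u 0) * (L.ySum 0 - 1 - L.zSum 0) := by
  classical
  have h1 : 1 ∉ L.Z₀ := fun h ↦ by
    have := L.Z₀_neg 1 h
    rw [L.φ_one] at this
    have := L.p_pos
    omega
  have hs : insert 1 L.Z₀ ⊆ L.Y₀ := Finset.insert_subset L.one_mem_Y₀ L.Z₀_subset
  have e : L.ySum 0 - 1 - L.zSum 0 = ∑ y ∈ L.Y₀ \ insert 1 L.Z₀, a y := by
    rw [Finset.sum_sdiff_eq_sub hs, Finset.sum_insert h1, map_one, sub_sub]
    rfl
  rw [e, Finset.mul_sum, Finset.sum_mul]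
  refine Finset.sum_congr rfl fun y hy ↦ ?_
  obtain ⟨hy, hy'⟩ := Finset.mem_sdiff.1 hy
  rw [Finset.mem_insert, not_or] at hy'
  rcases L.Y₀_step hN y hy with h | h | ⟨i, hi, -, h⟩
  · exact absurd h hy'.1
  · exact absurd h hy'.2
  · calc L.ySum 0 * a (L.u 0) * a y * a (L.u 0) = L.ySum 0 * a (L.u 0 * y * L.u 0) := by
          simp only [map_mul, mul_assoc]
      _ = L.ySum 0 * a y * a (L.u 0) * a y := by
          rw [u, h]; simp only [map_mul, mul_assoc]
      _ = _ := by rw [L.ySum_zero_mul hy]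

theorem relations : LadderRelations L.Z₀.card N L.ySum L.zSum (fun k ↦ a (L.u k)) where
  sq k := by rw [← map_mul, L.u_mul_u, map_one]
  y_succ := L.ySum_succ
  z_succ k _ := L.zSum_succ k
  u_comm_y k hk := Commute.sum_right _ _ _ fun y hy ↦ (L.u_commute_Y k hk hy).map _
  u_comm_z k hk := Commute.sum_right _ _ _ fun y hy ↦
    (L.u_commute_Y k hk (L.Z_subset_Y k hy)).map _
  u_comm_y_zero k hk := Commute.sum_right _ _ _ fun y hy ↦ (L.u_commute (k + 1) hk
    (cs.parabolic_mono (L.K_mono (by omega) (by omega)) (L.Y₀_subset y hy))).map _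
  u_comm_z_zero k hk := Commute.sum_right _ _ _ fun y hy ↦ (L.u_commute (k + 1) hk
    (cs.parabolic_mono (L.K_mono (by omega) (by omega)) (L.Y₀_subset y (L.Z₀_subset hy)))).map _
  u_comm_u k j hk hj := (L.u_commute k hk (cs.parabolic_mono (L.K_mono hj (by omega))
    (L.u_mem j (by omega)))).map _
  braid k hk := by simp only [← map_mul, L.u_braid k hk]
  z_mul_z := by
    rcases L.Z₀_eq with h | ⟨z, -, h2, h⟩
    · simp [zSum, Z, h]
    · simp only [zSum, Z, h, Finset.sum_singleton, ← map_mul, h2, map_one]; simp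
  d_mul_z := by
    rcases L.Z₀_eq with h | ⟨z, -, h2, h⟩ <;> simp [zSum, Z, h]
  y_mul_z := by
    rcases L.Z₀_eq with h | ⟨z, h1, h2, h⟩
    · simp [zSum, Z, h]
    · simp only [zSum, Z, h, Finset.sum_singleton, L.ySum_zero_mul h1]; simp
  z_comm_y hN := Commute.sum_left _ _ _ fun z hz ↦ L.commute_ySum_zero hN hz
  z_comm_z hN := Commute.sum_left _ _ _ fun z hz ↦ Commute.sum_right _ _ _ fun z' hz' ↦ by
    obtain ⟨w, hw, rfl⟩ := L.mem_Z_succ.1 hz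
    obtain rfl := L.Z_subsingleton 0 hw hz'
    exact (L.Z₀_comm hN w hw).map _
  base := L.relations_base

section Finite

variable [Fintype W]

open Classical in
/-- The sum of the minimal representatives of the left cosets of the parabolic subgroup of `K j`
in that of `K m`. -/
noncomputable def xSum (m j : ℕ) : MonoidAlgebra ℚ W :=
  ∑ w : W with w ∈ cs.parabolic (L.K m) ∧ w ∈ cs.minReps (L.K j), a w

theorem xSum_self (j : ℕ) (hj : j ≤ N) : L.xSum j j = 1 := by
  classical
  rw [xSum, ← map_one a, ← Finset.sum_singleton a 1]
  congr 1
  ext w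
  simp only [Finset.mem_filter, Finset.mem_univ, true_and, Finset.mem_singleton]
  refine ⟨fun h ↦ L.eq_one_of_mem_minReps j hj h.1 h.2, ?_⟩
  rintro rfl
  exact ⟨one_mem _, one_mem_minReps _⟩

/-- By unique factorisation and additivity of lengths, `(y, v) ↦ y * v` is a bijection onto the
representatives one level up. -/
theorem xSum_succ (m j : ℕ) (hm : m + 1 ≤ N) (hj : j ≤ m) :
    L.xSum (m + 1) j = L.ySum m * L.xSum m j := by
  classical
  rw [xSum, xSum, ySum, Finset.sum_mul_sum, ← Finset.sum_product']
  symm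
  have hmem : ∀ q : W × W, q ∈ L.Y m ×ˢ Finset.univ.filter (fun w ↦
      w ∈ cs.parabolic (L.K m) ∧ w ∈ cs.minReps (L.K j)) ↔ q.1 ∈ L.Y m ∧
        q.2 ∈ cs.parabolic (L.K m) ∧ q.2 ∈ cs.minReps (L.K j) := by simp
  refine Finset.sum_nbij (fun q ↦ q.1 * q.2) ?_ ?_ ?_ ?_
  · intro q hq
    obtain ⟨h1, h2, h3⟩ := (hmem q).1 hq
    rw [Finset.mem_filter]
    exact ⟨Finset.mem_univ _, mul_mem (L.Y_subset_parabolic m hm h1)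
      (cs.parabolic_mono (L.K_subset_succ m hm) h2), (L.mul_mem_minReps_iff m hm h1 h2 hj).2 h3⟩
  · intro q hq q' hq' h
    obtain ⟨h1, h2, -⟩ := (hmem q).1 hq
    obtain ⟨h1', h2', -⟩ := (hmem q').1 hq'
    obtain ⟨e1, e2⟩ := L.factor_unique m hm h1 h1' h2 h2' h
    exact Prod.ext e1 e2
  · intro w hw
    obtain ⟨-, h1, h2⟩ := Finset.mem_filter.1 hw
    obtain ⟨y, hy, v, hv, rfl⟩ := L.exists_factor m hm h1
    exact ⟨(y, v), (hmem _).2 ⟨hy, hv, (L.mul_mem_minReps_iff m hm hy hv hj).1 h2⟩, rfl⟩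
  · intro q _
    rw [map_mul]

theorem xSum_top (j : ℕ) : L.xSum N j = cs.descentElt (L.K j) := by
  classical
  have h : ∀ w, w ∈ cs.parabolic (L.K N) := fun w ↦ by
    rw [L.K_top, parabolic, Set.image_univ, cs.subgroup_closure_range_simple]
    trivial
  rw [xSum, descentElt]
  congr 1
  ext w
  simp [h]

/-- Induction on `m`: `xSum (m + 2) (j + 1)` begins with `y (m + 1)`, and the quadratic relation
passes multiplication by it on to `y m`, adding `d + 1` to the coefficient. -/
theorem ySum_mul_xSum (m j : ℕ) (hm : m + 1 ≤ N) (hj : j ≤ m) :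
    L.ySum m * L.xSum (m + 1) (j + 1) =
      ((L.Z₀.card + 1) * (m - j) : ℕ) * L.xSum (m + 1) (j + 1) + L.xSum (m + 1) j := by
  induction m, hj using Nat.le_induction with
  | base => simp [L.xSum_self _ hm, L.xSum_succ j j hm le_rfl, L.xSum_self j (by omega)]
  | succ m hjm ih =>
    have ih := ih (by omega)
    have hsq := L.relations.sq_eq m hm
    have hc := (Nat.cast_commute ((L.Z₀.card + 1) * (m - j)) (L.ySum (m + 1))).eq
    rw [L.xSum_succ (m + 1) (j + 1) hm (by omega), L.xSum_succ (m + 1) j hm (by omega),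
      ← mul_assoc, hsq, add_mul, mul_assoc _ (L.ySum m), ih, mul_add, ← mul_assoc (L.ySum (m + 1)),
      ← hc, Nat.succ_sub hjm]
    push_cast
    noncomm_ring

/-- The same induction, now starting from `y 0 * y 0 = |Y₀| * y 0`, which holds because `Y₀` is a
subgroup. -/
theorem ySum_mul_xSum_zero (m : ℕ) (hm : m + 1 ≤ N) :
    L.ySum m * L.xSum (m + 1) 0 =
      (L.Y₀.card + (L.Z₀.card + 1) * m : ℕ) * L.xSum (m + 1) 0 := by
  induction m with
  | zero =>
    rw [L.xSum_succ 0 0 hm le_rfl, L.xSum_self 0 (by omega), mul_one,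
      L.ySum_zero_mul_ySum_zero]
    simp
  | succ m ih =>
    have ih := ih (by omega)
    have hsq := L.relations.sq_eq m hm
    have hc := (Nat.cast_commute (L.Y₀.card + (L.Z₀.card + 1) * m) (L.ySum (m + 1))).eq
    rw [L.xSum_succ (m + 1) 0 hm (by omega), ← mul_assoc, hsq, add_mul, mul_assoc _ (L.ySum m), ih,
      ← mul_assoc (L.ySum (m + 1)), ← hc]
    push_cast
    noncomm_ring

end Finite

end Ladder

end CoxeterSystem

/-! ### The native basis attached to a tower -/

namespace CoxeterSystem

variable {ι W : Type*} [Group W] {M : CoxeterMatrix ι}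

open Classical in
theorem coeff_descentElt [Fintype W] (cs : CoxeterSystem M W) (J : Set ι) (w : W) :
    (cs.descentElt J).coeff w = if w ∈ cs.minReps J then 1 else 0 := by
  rw [descentElt, MonoidAlgebra.coeff_sum, Finsupp.finsetSum_apply]
  simp [MonoidAlgebra.of_apply, Finsupp.single_apply, Finset.sum_ite_eq']

namespace Ladder

variable {cs : CoxeterSystem M W} {N : ℕ} (L : Ladder cs N)

theorem exists_ne_one_mem_Y (k : ℕ) : ∃ y ∈ L.Y k, y ≠ 1 := by
  cases k with
  | zero => exact L.Y₀_ne
  | succ k =>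
    refine ⟨L.u k, L.mem_Y_succ.2 (.inr (.inl ⟨1, L.one_mem_Y k, one_mul _⟩)), fun h ↦ ?_⟩
    have := cs.length_simple (L.t k)
    rw [show cs.simple (L.t k) = 1 from h, cs.length_one] at this
    omega

/-- A witness for triangularity: any nontrivial element of `Y k` is minimal for `K k`, but not for
`K (k + 1)`, in whose parabolic subgroup it lies. -/
theorem exists_mem_minReps (k : ℕ) (hk : k ≤ N) :
    ∃ w ∈ cs.minReps (L.K k), ∀ j, k < j → j ≤ N → w ∉ cs.minReps (L.K j) := by
  rcases hk.eq_or_lt with rfl | hk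
  · exact ⟨1, one_mem_minReps _, fun j h1 h2 ↦ absurd h1 (by omega)⟩
  · obtain ⟨y, hy, hy1⟩ := L.exists_ne_one_mem_Y k
    refine ⟨y, ?_, fun j hj hj' h ↦ hy1 ?_⟩
    · have := L.mul_mem_minReps_iff k hk hy (one_mem _) le_rfl
      rw [mul_one] at this
      exact this.2 (one_mem_minReps _)
    · exact L.eq_one_of_mem_minReps (k + 1) hk (L.Y_subset_parabolic k hk hy)
        fun i hi ↦ h i (L.K_mono hj hj' hi)

variable [Fintype W]

theorem linearIndependent :
    LinearIndependent ℚ fun k : Fin (N + 1) ↦ cs.descentElt (L.K k) := by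
  classical
  rw [Fintype.linearIndependent_iff]
  intro g hg i
  induction i using WellFoundedLT.induction with
  | _ i ih =>
    obtain ⟨w, hw, hw'⟩ := L.exists_mem_minReps i (by omega)
    have h := congrArg (fun x ↦ x.coeff w) hg
    simp only [MonoidAlgebra.coeff_sum, Finsupp.finsetSum_apply, MonoidAlgebra.coeff_smul_apply,
      coeff_descentElt, MonoidAlgebra.coeff_zero, Finsupp.zero_apply] at h
    rw [Finset.sum_eq_single i] at h
    · simpa [hw] using h
    · intro j _ hj
      rcases lt_or_gt_of_ne hj with hj | hj
      · rw [ih j hj, zero_smul]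
      · rw [if_neg (hw' j hj (by omega)), smul_zero]
    · simp

theorem descentElt_inj {j k : ℕ} (hj : j ≤ N) (hk : k ≤ N)
    (h : cs.descentElt (L.K j) = cs.descentElt (L.K k)) : j = k := by
  have := L.linearIndependent.injective
    (show (fun k : Fin (N + 1) ↦ cs.descentElt (L.K k)) ⟨j, by omega⟩ =
      (fun k : Fin (N + 1) ↦ cs.descentElt (L.K k)) ⟨k, by omega⟩ from h)
  simpa using this

theorem descentElt_top : cs.descentElt (L.K N) = 1 := by
  rw [← L.xSum_top, L.xSum_self N le_rfl]

theorem descentElt_pred : cs.descentElt (L.K (N - 1)) = L.ySum (N - 1) := by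
  have h := L.one_le
  have := L.xSum_succ (N - 1) (N - 1) (by omega) le_rfl
  rwa [Nat.sub_add_cancel h, L.xSum_self _ (by omega), mul_one, L.xSum_top] at this

theorem descentElt_mul_succ (j : ℕ) (hj : j + 1 ≤ N) : ∃ c : ℕ,
    cs.descentElt (L.K (N - 1)) * cs.descentElt (L.K (j + 1)) =
      c * cs.descentElt (L.K (j + 1)) + cs.descentElt (L.K j) := by
  have h := L.one_le
  have := L.ySum_mul_xSum (N - 1) j (by omega) (by omega)
  rw [Nat.sub_add_cancel h, L.xSum_top, L.xSum_top, ← L.descentElt_pred] at this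
  exact ⟨_, this⟩

theorem descentElt_mul_zero : ∃ c : ℕ,
    cs.descentElt (L.K (N - 1)) * cs.descentElt (L.K 0) = c * cs.descentElt (L.K 0) := by
  have h := L.one_le
  have := L.ySum_mul_xSum_zero (N - 1) (by omega)
  rw [Nat.sub_add_cancel h, L.xSum_top, ← L.descentElt_pred] at this
  exact ⟨_, this⟩

/-- Descending from `x_N = 1`, the multiplication rule reads `x_k = (x_{N-1} - c) x_{k+1}`, with `c`
a natural number; hence the coefficients are integers. -/
theorem exists_polynomial (k : ℕ) (hk : k ≤ N) : ∃ p : Polynomial ℤ, cs.descentElt (L.K k) =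
    Polynomial.aeval (cs.descentElt (L.K (N - 1))) (p.map (Int.castRingHom ℚ)) := by
  induction hk using Nat.decreasingInduction with
  | self => exact ⟨1, by simp [L.descentElt_top]⟩
  | of_succ k hk ih =>
    obtain ⟨p, hp⟩ := ih
    obtain ⟨c, hc⟩ := L.descentElt_mul_succ k hk
    refine ⟨Polynomial.X * p - (c : Polynomial ℤ) * p, ?_⟩
    simp only [Polynomial.map_sub, Polynomial.map_mul, Polynomial.map_X, Polynomial.map_natCast,
      map_sub, map_mul, Polynomial.aeval_X, map_natCast, ← hp, hc]
    abel

theorem span_eq :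
    Submodule.span ℚ (cs.descentElt '' {J | ∃ k ≤ N, J = L.K k}) =
      Subalgebra.toSubmodule (Algebra.adjoin ℚ {cs.descentElt (L.K (N - 1))}) := by
  set x := cs.descentElt (L.K (N - 1)) with hx
  set S := Submodule.span ℚ (cs.descentElt '' {J | ∃ k ≤ N, J = L.K k})
  have hmem : ∀ k ≤ N, cs.descentElt (L.K k) ∈ S := fun k hk ↦
    Submodule.subset_span ⟨_, ⟨k, hk, rfl⟩, rfl⟩
  apply le_antisymm
  · rw [Submodule.span_le]
    rintro _ ⟨_, ⟨k, hk, rfl⟩, rfl⟩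
    obtain ⟨p, hp⟩ := L.exists_polynomial k hk
    rw [hp]
    exact Polynomial.aeval_mem_adjoin_singleton ℚ x
  -- The span contains 1 and is stable under left multiplication by `x`, hence contains all powers
  -- of `x`.
  · have hmul : ∀ w ∈ S, x * w ∈ S := by
      intro w hw
      induction hw using Submodule.span_induction with
      | mem w hw =>
        obtain ⟨_, ⟨k, hk, rfl⟩, rfl⟩ := hw
        have hc : ∀ c : ℕ, (c : MonoidAlgebra ℚ W) * cs.descentElt (L.K k) ∈ S := fun c ↦ by
          rw [← nsmul_eq_mul]
          exact S.nsmul_mem (hmem k hk) c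
        cases k with
        | zero =>
          obtain ⟨c, e⟩ := L.descentElt_mul_zero
          rw [hx, e]
          exact hc c
        | succ k =>
          obtain ⟨c, e⟩ := L.descentElt_mul_succ k hk
          rw [hx, e]
          exact add_mem (hc c) (hmem k (by omega))
      | zero => simp
      | add v w _ _ hv hw => rw [mul_add]; exact add_mem hv hw
      | smul r w _ hw => rw [mul_smul_comm]; exact S.smul_mem r hw
    have hpow : ∀ m : ℕ, x ^ m ∈ S := by
      intro m
      induction m with
      | zero => rw [pow_zero, ← L.descentElt_top]; exact hmem N le_rfl
      | succ m ih => rw [pow_succ']; exact hmul _ ih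
    intro w hw
    rw [Subalgebra.mem_toSubmodule, Algebra.adjoin_singleton_eq_range_aeval] at hw
    obtain ⟨p, rfl⟩ := hw
    change Polynomial.aeval x p ∈ S
    rw [Polynomial.aeval_eq_sum_range]
    exact S.sum_mem fun m _ ↦ S.smul_mem _ (hpow m)

theorem isNativeBasis :
    cs.IsNativeBasis (Algebra.adjoin ℚ {cs.descentElt (L.K (N - 1))})
      (cs.descentElt '' {J | ∃ k ≤ N, J = L.K k}) := by
  refine ⟨Set.image_subset_range _ _, ?_, L.span_eq⟩
  refine L.linearIndependent.linearIndepOn_id.mono ?_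
  rintro _ ⟨_, ⟨k, hk, rfl⟩, rfl⟩
  exact ⟨⟨k, by omega⟩, rfl⟩

theorem injOn : Set.InjOn cs.descentElt {J | ∃ k ≤ N, J = L.K k} := by
  rintro _ ⟨j, hj, rfl⟩ _ ⟨k, hk, rfl⟩ h
  rw [L.descentElt_inj hj hk h]

end Ladder

end CoxeterSystem

/-! ### Signed transpositions and the Coxeter relations -/

theorem mul_pow_two_of_conj {G : Type*} [Monoid G] {a b : G} (hb : b * b = 1)
    (h : a * b * a = b) : (a * b) ^ 2 = 1 := by
  rw [pow_two, ← mul_assoc, h, hb]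

theorem mul_pow_three_of_braid {G : Type*} [Monoid G] {a b : G} (ha : a * a = 1) (hb : b * b = 1)
    (h : a * b * a = b * a * b) : (a * b) ^ 3 = 1 := by
  calc (a * b) ^ 3 = (a * b * a) * (b * a * b) := by
        simp only [pow_succ, pow_zero, one_mul, mul_assoc]
    _ = a * b * (a * a) * b * a := by rw [← h]; simp only [mul_assoc]
    _ = 1 := by rw [ha, mul_one, mul_assoc a, hb, mul_one, ha]

theorem mul_pow_four_of_conj {G : Type*} [Monoid G] {a b : G} (ha : a * a = 1) (hb : b * b = 1)
    (h : b * (a * b * a) * b = a * b * a) : (a * b) ^ 4 = 1 := by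
  calc (a * b) ^ 4 = a * (b * (a * b * a) * b) * a * b := by
        simp only [pow_succ, pow_zero, one_mul, mul_assoc]
    _ = (a * a) * b * (a * a) * b := by rw [h]; simp only [mul_assoc]
    _ = 1 := by rw [ha, one_mul, mul_one, hb]

theorem mul_pow_comm_of_sq {G : Type*} [Monoid G] {a b : G} (ha : a * a = 1) {m : ℕ}
    (h : (a * b) ^ m = 1) : (b * a) ^ m = 1 := by
  have hs : SemiconjBy a (a * b) (b * a) := by
    change a * (a * b) = b * a * a
    rw [← mul_assoc, ha, mul_assoc, ha, one_mul, mul_one]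
  have h1 := (hs.pow_right m).eq
  rw [h, mul_one] at h1
  calc (b * a) ^ m = (b * a) ^ m * a * a := by rw [mul_assoc, ha, mul_one]
    _ = 1 := by rw [← h1, ha]

theorem CoxeterMatrix.isLiftable_of_lt {G : Type*} [Monoid G] {n : ℕ}
    (M : CoxeterMatrix (Fin n)) {f : Fin n → G} (hf : ∀ i, f i * f i = 1)
    (h : ∀ i j, i < j → (f i * f j) ^ M i j = 1) : M.IsLiftable f := by
  intro i j
  rcases lt_trichotomy i j with hij | rfl | hij
  · exact h i j hij
  · rw [M.diagonal, pow_one, hf]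
  · rw [M.symmetric]
    exact mul_pow_comm_of_sq (hf j) (h j i hij)

namespace CoxeterSystem

variable {ι W : Type*} [Group W] {M : CoxeterMatrix ι} (cs : CoxeterSystem M W)

theorem commute_of_eq_two {i j : ι} (h : M i j = 2) : Commute (cs.simple i) (cs.simple j) := by
  have h1 := cs.simple_mul_simple_pow i j
  rw [h, pow_two] at h1
  have h2 := eq_inv_of_mul_eq_one_left h1
  rwa [mul_inv_rev, cs.inv_simple, cs.inv_simple] at h2

theorem braid_of_eq_three {i j : ι} (h : M i j = 3) :
    cs.simple i * cs.simple j * cs.simple i = cs.simple j * cs.simple i * cs.simple j := by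
  have h1 := cs.simple_mul_simple_pow i j
  have h2 : (cs.simple i * cs.simple j * cs.simple i) *
      (cs.simple j * cs.simple i * cs.simple j) = 1 := by
    rw [← h1, h]; simp only [pow_succ, pow_zero, one_mul, mul_assoc]
  have h3 := eq_inv_of_mul_eq_one_left h2
  simpa only [mul_inv_rev, cs.inv_simple, mul_assoc] using h3

end CoxeterSystem

/-- The signed permutation of the integers that exchanges `a` and `b`, and `-a` and `-b`. -/
def signedSwap (a b : ℤ) : Function.End ℤ := fun x ↦
  if x = a then b else if x = b then a else if x = -a then -b else if x = -b then -a else x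

namespace signedSwap

theorem apply (a b x : ℤ) : signedSwap a b x =
  if x = a then b else if x = b then a else if x = -a then -b else if x = -b then -a else x := rfl

theorem symm (a b : ℤ) : signedSwap a b = signedSwap b a := by
  funext x; simp only [apply]; grind

/-- A signed transposition `signedSwap a b` for which the exchange is well defined. -/
def Good (a b : ℤ) : Prop := a ≠ 0 ∧ b ≠ 0 ∧ (b = -a ∨ (a ≠ b ∧ a ≠ -b))

theorem neg {a b : ℤ} (h : Good a b) : signedSwap (-a) (-b) = signedSwap a b := by
  unfold Good at h; funext x; simp only [apply]; grind

theorem apply_apply {a b : ℤ} (h : Good a b) (x : ℤ) :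
    signedSwap a b (signedSwap a b x) = x := by
  unfold Good at h; simp only [apply]; grind

theorem apply_neg {a b : ℤ} (h : Good a b) (x : ℤ) :
    signedSwap a b (-x) = -signedSwap a b x := by
  unfold Good at h; simp only [apply]; grind

theorem sq {a b : ℤ} (h : Good a b) : signedSwap a b * signedSwap a b = 1 :=
  funext fun x ↦ apply_apply h x

/-- Conjugation by an involution that commutes with negation relabels the exchanged points. All the
Coxeter relations needed below reduce to this. -/
theorem conj {a b : ℤ} (h : Good a b) (c d : ℤ) :
    signedSwap a b * signedSwap c d * signedSwap a b =
      signedSwap (signedSwap a b c) (signedSwap a b d) := by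
  funext x
  change signedSwap a b (signedSwap c d (signedSwap a b x)) = _
  have h1 := apply_apply h
  have h2 := apply_neg h
  generalize signedSwap a b = g at *
  simp only [apply]
  grind

theorem mul_pow_two {a b c d : ℤ} (h : Good a b) (h' : Good c d)
    (hc : signedSwap a b c = c) (hd : signedSwap a b d = d) :
    (signedSwap a b * signedSwap c d) ^ 2 = 1 :=
  mul_pow_two_of_conj (sq h') (by rw [conj h, hc, hd])

theorem mul_pow_three {a b c : ℤ} (h : Good a b) (h' : Good b c) (hac : a ≠ c) (hac' : a ≠ -c)
    (hab : a ≠ b) (hab' : a ≠ -b) (hbc : b ≠ c) (hbc' : b ≠ -c) :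
    (signedSwap a b * signedSwap b c) ^ 3 = 1 := by
  refine mul_pow_three_of_braid (sq h) (sq h') ?_
  unfold Good at h h'
  rw [conj h, conj h']
  congr 1 <;> simp only [apply] <;> grind

end signedSwap

namespace ClassicalType

/-- The pair of integers exchanged by the `i`-th simple reflection (counted from `0`) in its action
by a signed transposition. -/
def swapPair (T : ClassicalType) (i : ℕ) : ℤ × ℤ :=
  match T, i with
  | A, i => (i + 1, i + 2)
  | B, 0 => (1, -1)
  | D, 0 => (-1, 2)
  | _, i + 1 => (i + 1, i + 2)

/-- The action of the `i`-th simple reflection on the integers. -/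
def signedPerm (T : ClassicalType) (i : ℕ) : Function.End ℤ :=
  signedSwap (T.swapPair i).1 (T.swapPair i).2

theorem swapPair_good (T : ClassicalType) (i : ℕ) :
    signedSwap.Good (T.swapPair i).1 (T.swapPair i).2 := by
  unfold signedSwap.Good
  rcases T <;> rcases i with _ | i <;> simp only [swapPair] <;> grind

theorem coxeterMatrix_A (n : ℕ) (i j : Fin n) : A.coxeterMatrix n i j =
    if i = j then 1 else if (j : ℕ) + 1 = i ∨ (i : ℕ) + 1 = j then 3 else 2 := rfl

theorem coxeterMatrix_B (n : ℕ) (i j : Fin n) : B.coxeterMatrix n i j =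
    if i = j then 1 else if ((i : ℕ) = 0 ∧ (j : ℕ) = 1) ∨ ((i : ℕ) = 1 ∧ (j : ℕ) = 0) then 4
    else if (j : ℕ) + 1 = i ∨ (i : ℕ) + 1 = j then 3 else 2 := by
  change (if i.rev = j.rev then 1 else if _ then _ else if _ then _ else _) = _
  simp only [Fin.revPerm_symm, Fin.revPerm_apply, Fin.ext_iff, Fin.val_rev]
  have hi := i.isLt
  have hj := j.isLt
  split_ifs <;> first | rfl | (exfalso; omega)

theorem coxeterMatrix_D (n : ℕ) (i j : Fin n) : D.coxeterMatrix n i j =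
    if i = j then 1
    else if ((i : ℕ) = 0 ∧ (j : ℕ) = 2) ∨ ((j : ℕ) = 0 ∧ (i : ℕ) = 2)
        ∨ (1 ≤ (i : ℕ) ∧ (i : ℕ) + 1 = j) ∨ (1 ≤ (j : ℕ) ∧ (j : ℕ) + 1 = i) then 3
    else 2 := rfl

theorem isLiftable (T : ClassicalType) (n : ℕ) :
    (T.coxeterMatrix n).IsLiftable fun i ↦ T.signedPerm i := by
  refine CoxeterMatrix.isLiftable_of_lt _ (fun i ↦ signedSwap.sq (T.swapPair_good i)) ?_
  intro i j hij
  have gi := T.swapPair_good i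
  have gj := T.swapPair_good j
  have hne := hij.ne
  simp only [signedPerm]
  cases T with
  | A =>
    rw [coxeterMatrix_A, if_neg hne]
    split_ifs with h <;> obtain ⟨i, hi⟩ := i <;> obtain ⟨j, hj⟩ := j <;>
      simp only [Fin.mk_lt_mk] at hij h gi gj ⊢ <;>
      obtain ⟨j, rfl⟩ := Nat.exists_eq_succ_of_ne_zero (show j ≠ 0 by omega)
    all_goals simp only [swapPair] at gi gj ⊢
    · obtain rfl : i = j := by omega
      push_cast at gj ⊢
      rw [add_assoc, show (1 : ℤ) + 1 = 2 from rfl, add_assoc] at gj ⊢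
      exact signedSwap.mul_pow_three gi gj (by omega) (by omega) (by omega) (by omega) (by omega)
        (by omega)
    · refine signedSwap.mul_pow_two gi gj ?_ ?_ <;> simp only [signedSwap.apply] <;> grind
  | B =>
    rw [coxeterMatrix_B, if_neg hne]
    split_ifs with h h <;> obtain ⟨i, hi⟩ := i <;> obtain ⟨j, hj⟩ := j <;>
      simp only [Fin.mk_lt_mk] at * <;>
      obtain ⟨j, rfl⟩ := Nat.exists_eq_succ_of_ne_zero (show j ≠ 0 by omega)
    · obtain ⟨rfl, rfl⟩ : i = 0 ∧ j = 0 := by omega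
      refine mul_pow_four_of_conj (signedSwap.sq gi) (signedSwap.sq gj) ?_
      -- Conjugating the pair (1, 2) by the sign change of 1 gives (-1, 2); conjugating this by the
      -- exchange of 1 and 2 gives (-2, 1), which is the same signed transposition.
      rw [signedSwap.conj gi, signedSwap.conj gj]
      have h1 := signedSwap.neg (a := 1) (b := -2) (by simp [signedSwap.Good])
      simpa [swapPair, signedSwap.apply, signedSwap.symm (-2)] using h1.symm
    · obtain ⟨i, rfl⟩ := Nat.exists_eq_succ_of_ne_zero (show i ≠ 0 by omega)
      obtain rfl : i + 1 = j := by omega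
      simp only [swapPair] at gi gj ⊢
      push_cast at gj ⊢
      rw [add_assoc, show (1 : ℤ) + 1 = 2 from rfl, add_assoc] at gj ⊢
      exact signedSwap.mul_pow_three gi gj (by omega) (by omega) (by omega) (by omega) (by omega)
        (by omega)
    · refine signedSwap.mul_pow_two gi gj ?_ ?_ <;> rcases i with _ | i <;>
        simp only [swapPair, signedSwap.apply] <;> grind
  | D =>
    rw [coxeterMatrix_D, if_neg hne]
    split_ifs with h <;> obtain ⟨i, hi⟩ := i <;> obtain ⟨j, hj⟩ := j <;>
      simp only [Fin.mk_lt_mk] at hij h gi gj ⊢ <;>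
      obtain ⟨j, rfl⟩ := Nat.exists_eq_succ_of_ne_zero (show j ≠ 0 by omega)
    · rcases i with _ | i
      · obtain rfl : j = 1 := by omega
        exact signedSwap.mul_pow_three gi gj (by simp [swapPair]) (by simp [swapPair])
          (by simp [swapPair]) (by simp [swapPair]) (by simp [swapPair]) (by simp [swapPair])
      · obtain rfl : i + 1 = j := by omega
        simp only [swapPair] at gi gj ⊢
        push_cast at gj ⊢
        rw [add_assoc, show (1 : ℤ) + 1 = 2 from rfl, add_assoc] at gj ⊢
        exact signedSwap.mul_pow_three gi gj (by omega) (by omega) (by omega) (by omega)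
          (by omega) (by omega)
    · rcases i with _ | i
      · rcases j with _ | j
        · refine mul_pow_two_of_conj (signedSwap.sq gj) ?_
          -- The exchange of -1 and 2 carries the pair (1, 2) to (-2, -1), which defines the same
          -- signed transposition.
          rw [signedSwap.conj gi, ← signedSwap.neg
            (by simp [swapPair, signedSwap.apply, signedSwap.Good]), signedSwap.symm]
          simp [swapPair, signedSwap.apply]
        · refine signedSwap.mul_pow_two gi gj ?_ ?_ <;>
            simp only [swapPair, signedSwap.apply] <;> grind
      · refine signedSwap.mul_pow_two gi gj ?_ ?_ <;>
          simp only [swapPair, signedSwap.apply] <;> grind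

end ClassicalType

/-! ### Parabolic subgroups determine their generators; the tower of type A -/

namespace ClassicalType

/-- The set separates the `i`-th reflection from the subgroup generated by the others. A half-line
works except at the second fork node of type D, where 1 has to be replaced by -1. -/
theorem exists_invariant (T : ClassicalType) (i : ℕ) : ∃ Ω : Set ℤ,
    (∀ j ≠ i, ∀ x ∈ Ω, T.signedPerm j x ∈ Ω) ∧ ∃ x ∈ Ω, T.signedPerm i x ∉ Ω := by
  cases T with
  | A =>
    refine ⟨{x | (i : ℤ) + 2 ≤ x}, ?_, i + 2, ?_, ?_⟩ <;>
      simp only [signedPerm, swapPair, signedSwap.apply, Set.mem_ofPred_eq] <;> grind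
  | B =>
    refine ⟨{x | (i : ℤ) + 1 ≤ x}, ?_, i + 1, ?_, ?_⟩
    · rintro (_ | j) hj <;>
        simp only [signedPerm, swapPair, signedSwap.apply, Set.mem_ofPred_eq] <;> grind
    · simp
    · rcases i with _ | i <;>
        simp only [signedPerm, swapPair, signedSwap.apply, Set.mem_ofPred_eq] <;> grind
  | D =>
    rcases i with _ | _ | i
    · refine ⟨{x | 1 ≤ x}, ?_, 2, ?_, ?_⟩
      · rintro (_ | j) hj <;>
          simp only [signedPerm, swapPair, signedSwap.apply, Set.mem_ofPred_eq] <;> grind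
      · simp
      · simp only [signedPerm, swapPair, signedSwap.apply, Set.mem_ofPred_eq]; grind
    · refine ⟨{x | x = -1 ∨ 2 ≤ x}, ?_, 2, ?_, ?_⟩
      · rintro (_ | j) hj <;>
          simp only [signedPerm, swapPair, signedSwap.apply, Set.mem_ofPred_eq] <;> grind
      · simp
      · simp only [signedPerm, swapPair, signedSwap.apply, Set.mem_ofPred_eq]; grind
    · refine ⟨{x | (i : ℤ) + 3 ≤ x}, ?_, i + 3, ?_, ?_⟩
      · rintro (_ | j) hj <;>
          simp only [signedPerm, swapPair, signedSwap.apply, Set.mem_ofPred_eq] <;> grind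
      · simp
      · simp only [signedPerm, swapPair, signedSwap.apply, Set.mem_ofPred_eq]; grind

variable {n : ℕ} {W : Type*} [Group W]

/-- The action of a classical Coxeter group by signed permutations of the integers. -/
noncomputable def rep (T : ClassicalType) (cs : CoxeterSystem (T.coxeterMatrix n) W) :
    W →* Function.End ℤ :=
  cs.lift ⟨fun i ↦ T.signedPerm i, T.isLiftable n⟩

@[simp] theorem rep_simple (T : ClassicalType) (cs : CoxeterSystem (T.coxeterMatrix n) W)
    (i : Fin n) : T.rep cs (cs.simple i) = T.signedPerm i :=
  cs.lift_apply_simple (T.isLiftable n) i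

theorem mem_of_simple_mem_parabolic (T : ClassicalType)
    (cs : CoxeterSystem (T.coxeterMatrix n) W) {J : Set (Fin n)} {i : Fin n}
    (h : cs.simple i ∈ cs.parabolic J) : i ∈ J := by
  by_contra hi
  obtain ⟨Ω, hΩ, x, hx, hx'⟩ := T.exists_invariant i
  obtain ⟨ω, hω, e⟩ := cs.exists_word_of_mem_parabolic h
  have key : ∀ ω : List (Fin n), (∀ j ∈ ω, j ∈ J) → T.rep cs (cs.wordProd ω) x ∈ Ω := by
    intro ω hω
    induction ω with
    | nil => rw [cs.wordProd_nil, map_one]; exact hx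
    | cons j ω ih =>
      rw [cs.wordProd_cons, map_mul, rep_simple]
      refine hΩ j ?_ _ (ih fun k hk ↦ hω k (List.mem_cons_of_mem _ hk))
      intro hj
      rw [← Fin.ext hj] at hi
      exact hi (hω j List.mem_cons_self)
  have := key ω hω
  rw [e, rep_simple] at this
  exact hx' this

theorem parabolic_injective (T : ClassicalType) (cs : CoxeterSystem (T.coxeterMatrix n) W) :
    Function.Injective cs.parabolic := by
  intro J J' h
  ext i
  exact ⟨fun hi ↦ T.mem_of_simple_mem_parabolic cs (h ▸ cs.simple_mem_parabolic hi),
    fun hi ↦ T.mem_of_simple_mem_parabolic cs (h ▸ cs.simple_mem_parabolic hi)⟩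

theorem mem_initialSet {T : ClassicalType} {j : ℕ} {i : Fin n} :
    i ∈ T.initialSet n j ↔ (i : ℕ) < j ∧ ¬(T = D ∧ j = 1) := by
  cases T <;> rcases j with _ | _ | j <;> simp [initialSet]

open Classical in
/-- The tower of parabolic subgroups of type `A`. -/
noncomputable def ladderA (hn : 1 ≤ n) (cs : CoxeterSystem (A.coxeterMatrix n) W) :
    cs.Ladder n where
  K k := A.initialSet n k
  -- The minimum only makes `t` total: it equals `k + 1` whenever `k + 2 ≤ n`.
  t k := ⟨min (k + 1) (n - 1), by omega⟩
  Y₀ := {1, cs.simple ⟨0, hn⟩}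
  Z₀ := ∅
  φ := A.rep cs
  -- The first `k` reflections permute 1, …, k + 1 and the negatives of these, so `k + 2` is the
  -- first positive integer beyond their support.
  p k := k + 2
  one_le := hn
  K_zero := by ext i; simp [mem_initialSet]
  K_top := by ext i; simp [mem_initialSet]
  K_succ k hk := by ext i; simp [mem_initialSet, Fin.ext_iff]; omega
  comm k hk i hi := by
    rw [mem_initialSet] at hi
    refine cs.commute_of_eq_two ?_
    rw [coxeterMatrix_A, if_neg (by simp only [Fin.ext_iff]; omega), if_neg (by simp only; omega)]
  braid k hk := by
    refine cs.braid_of_eq_three ?_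
    rw [coxeterMatrix_A, if_neg (by simp only [Fin.ext_iff]; omega), if_pos (by simp only; omega)]
  one_mem_Y₀ := by simp
  Y₀_subset y hy := by
    rw [Finset.mem_insert, Finset.mem_singleton] at hy
    rcases hy with rfl | rfl
    · exact one_mem _
    · exact cs.simple_mem_parabolic (by simp [mem_initialSet])
  Y₀_ne := ⟨_, Finset.mem_insert_of_mem (Finset.mem_singleton_self _), fun h ↦ by
    have := cs.length_simple ⟨0, hn⟩
    rw [h, cs.length_one] at this
    omega⟩
  Y₀_closed i hi y hy := by
    obtain rfl : i = ⟨0, hn⟩ := by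
      rw [mem_initialSet] at hi
      exact Fin.ext (by simp only; omega)
    rw [Finset.mem_insert, Finset.mem_singleton] at hy
    rcases hy with rfl | rfl <;> simp
  Z₀_subset := by simp
  Z₀_subsingleton := by simp
  Z₀_sq := by simp
  Y₀_step hN y hy := by
    rw [Finset.mem_insert, Finset.mem_singleton] at hy
    rcases hy with rfl | rfl
    · exact .inl rfl
    · refine .inr (.inr ⟨_, by simp [mem_initialSet], rfl, ?_⟩)
      refine cs.braid_of_eq_three ?_
      rw [coxeterMatrix_A, if_neg (by simp only [Fin.ext_iff]; omega),
        if_pos (by simp only; omega)]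
  Z₀_step := by simp
  Z₀_comm := by simp
  p_pos := by norm_num
  p_lt k := by push_cast; omega
  p_fixed k hk i hi := by
    rw [mem_initialSet] at hi
    simp only [rep_simple, signedPerm, swapPair, signedSwap.apply]; grind
  p_succ k hk := by
    simp only [rep_simple, signedPerm, swapPair, signedSwap.apply]; grind
  p_neg k hk := by
    simp only [rep_simple, signedPerm, swapPair, signedSwap.apply]; grind
  Y₀_inj y hy y' hy' h := by
    rw [Finset.mem_insert, Finset.mem_singleton] at hy hy'
    rcases hy with rfl | rfl <;> rcases hy' with rfl | rfl <;>
      simp_all [signedPerm, swapPair, signedSwap.apply, Function.End.one_def]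
  Y₀_le y hy := by
    rw [Finset.mem_insert, Finset.mem_singleton] at hy
    rcases hy with rfl | rfl <;>
      simp [signedPerm, swapPair, signedSwap.apply, Function.End.one_def]
  Z₀_neg := by simp

end ClassicalType

/-! ### The towers of types B and D -/

theorem signedSwap.mul_apply (f g : Function.End ℤ) (x : ℤ) : (f * g) x = f (g x) := rfl

/-- In type D, with `a` and `b` the fork reflections and `u` the node joined to both, this shows
that `u * (a * b) * u` exchanges the two fork reflections. -/
theorem fork_swap {G : Type*} [Monoid G] {a b u : G} (ha : a * u * a = u * a * u)
    (hb : b * u * b = u * b * u) : a * (u * (a * b) * u) = u * (a * b) * u * b := by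
  calc a * (u * (a * b) * u) = (a * u * a) * b * u := by simp only [mul_assoc]
    _ = u * a * (u * b * u) := by rw [ha]; simp only [mul_assoc]
    _ = _ := by rw [← hb]; simp only [mul_assoc]

theorem CoxeterSystem.commute_conj_of_eq_four {ι W : Type*} [Group W] {M : CoxeterMatrix ι}
    (cs : CoxeterSystem M W) {i j : ι} (h : M i j = 4) :
    Commute (cs.simple j * cs.simple i * cs.simple j) (cs.simple i) := by
  have h1 := cs.simple_mul_simple_pow i j
  have h2 : (cs.simple i * cs.simple j * cs.simple i * cs.simple j) *
      (cs.simple i * cs.simple j * cs.simple i * cs.simple j) = 1 := by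
    rw [← h1, h]; simp only [pow_succ, pow_zero, one_mul, mul_assoc]
  have h3 := eq_inv_of_mul_eq_one_left h2
  symm
  change _ = _
  simpa only [mul_inv_rev, cs.inv_simple, mul_assoc] using h3

namespace ClassicalType

variable {n : ℕ} {W : Type*} [Group W]

open Classical in
/-- The tower of parabolic subgroups of type `B`. -/
noncomputable def ladderB (hn : 2 ≤ n) (cs : CoxeterSystem (B.coxeterMatrix n) W) :
    cs.Ladder n where
  K k := B.initialSet n k
  t k := ⟨min (k + 1) (n - 1), by omega⟩
  Y₀ := {1, cs.simple ⟨0, by omega⟩}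
  Z₀ := {cs.simple ⟨0, by omega⟩}
  φ := B.rep cs
  p k := k + 1
  one_le := by omega
  K_zero := by ext i; simp [mem_initialSet]
  K_top := by ext i; simp [mem_initialSet]
  K_succ k hk := by ext i; simp [mem_initialSet, Fin.ext_iff]; omega
  comm k hk i hi := by
    rw [mem_initialSet] at hi
    refine cs.commute_of_eq_two ?_
    rw [coxeterMatrix_B, if_neg (by simp only [Fin.ext_iff]; omega), if_neg (by simp only; omega),
      if_neg (by simp only; omega)]
  braid k hk := by
    refine cs.braid_of_eq_three ?_
    rw [coxeterMatrix_B, if_neg (by simp only [Fin.ext_iff]; omega), if_neg (by simp only; omega),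
      if_pos (by simp only; omega)]
  one_mem_Y₀ := by simp
  Y₀_subset y hy := by
    rw [Finset.mem_insert, Finset.mem_singleton] at hy
    rcases hy with rfl | rfl
    · exact one_mem _
    · exact cs.simple_mem_parabolic (by simp [mem_initialSet])
  Y₀_ne := ⟨_, Finset.mem_insert_of_mem (Finset.mem_singleton_self _), fun h ↦ by
    have := cs.length_simple ⟨0, by omega⟩
    rw [h, cs.length_one] at this
    omega⟩
  Y₀_closed i hi y hy := by
    obtain rfl : i = ⟨0, by omega⟩ := by
      rw [mem_initialSet] at hi
      exact Fin.ext (by simp only; omega)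
    rw [Finset.mem_insert, Finset.mem_singleton] at hy
    rcases hy with rfl | rfl <;> simp
  Z₀_subset := by simp
  Z₀_subsingleton := by simp
  Z₀_sq := by simp
  Y₀_step hN y hy := by
    rw [Finset.mem_insert, Finset.mem_singleton] at hy
    rcases hy with rfl | rfl
    · exact .inl rfl
    · exact .inr (.inl (Finset.mem_singleton_self _))
  Z₀_step hN z hz i hi := by
    obtain rfl := Finset.mem_singleton.1 hz
    obtain rfl : i = ⟨0, by omega⟩ := by
      rw [mem_initialSet] at hi
      exact Fin.ext (by simp only; omega)
    refine ⟨_, hi, (cs.commute_conj_of_eq_four ?_).eq.symm⟩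
    rw [coxeterMatrix_B, if_neg (by simp only [Fin.ext_iff]; omega),
      if_pos (.inl ⟨rfl, by simp only; omega⟩)]
  Z₀_comm hN z hz := by
    obtain rfl := Finset.mem_singleton.1 hz
    refine cs.commute_conj_of_eq_four ?_
    rw [coxeterMatrix_B, if_neg (by simp only [Fin.ext_iff]; omega),
      if_pos (.inl ⟨rfl, by simp only; omega⟩)]
  p_pos := by norm_num
  p_lt k := by push_cast; omega
  p_fixed k hk i hi := by
    rw [mem_initialSet] at hi
    obtain ⟨_ | i, hi'⟩ := i <;>
      simp only [rep_simple, signedPerm, swapPair, signedSwap.apply] at hi ⊢ <;> grind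
  p_succ k hk := by
    rw [rep_simple]
    simp only [show min (k + 1) (n - 1) = k + 1 by omega]
    simp only [signedPerm, swapPair, signedSwap.apply]; grind
  p_neg k hk := by
    rw [rep_simple]
    simp only [show min (k + 1) (n - 1) = k + 1 by omega]
    simp only [signedPerm, swapPair, signedSwap.apply]; grind
  Y₀_inj y hy y' hy' h := by
    rw [Finset.mem_insert, Finset.mem_singleton] at hy hy'
    rcases hy with rfl | rfl <;> rcases hy' with rfl | rfl <;>
      simp [signedPerm, swapPair, signedSwap.apply, Function.End.one_def] at h ⊢
  Y₀_le y hy := by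
    rw [Finset.mem_insert, Finset.mem_singleton] at hy
    rcases hy with rfl | rfl <;>
      simp [signedPerm, swapPair, signedSwap.apply, Function.End.one_def]
  Z₀_neg z hz := by
    obtain rfl := Finset.mem_singleton.1 hz
    simp [signedPerm, swapPair, signedSwap.apply]

section D

variable (hn : 3 ≤ n) (cs : CoxeterSystem (D.coxeterMatrix n) W)

theorem simple_commute_fork :
    Commute (cs.simple ⟨0, by omega⟩) (cs.simple ⟨1, by omega⟩) := by
  refine cs.commute_of_eq_two ?_
  rw [coxeterMatrix_D, if_neg (by simp only [Fin.ext_iff]; omega), if_neg (by simp only; omega)]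

theorem simple_braid_fork {i : Fin n} (hi : (i : ℕ) < 2) {k : Fin n} (hk : (k : ℕ) = 2) :
    cs.simple i * cs.simple k * cs.simple i = cs.simple k * cs.simple i * cs.simple k := by
  refine cs.braid_of_eq_three ?_
  rw [coxeterMatrix_D, if_neg (by simp only [Fin.ext_iff]; omega), if_pos (by omega)]

open Classical in
/-- The tower of parabolic subgroups of type `D`. -/
noncomputable def ladderD : cs.Ladder (n - 1) where
  -- The shift starts the tower at `W_1`, which is trivial, so the first step adds both fork nodes
  -- at once and `Y₀` is a Klein four-group.
  K k := D.initialSet n (k + 1)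
  t k := ⟨min (k + 2) (n - 1), by omega⟩
  Y₀ := {1, cs.simple ⟨0, by omega⟩, cs.simple ⟨1, by omega⟩,
    cs.simple ⟨0, by omega⟩ * cs.simple ⟨1, by omega⟩}
  -- The product of the two fork reflections changes the signs of 1 and 2, so it sends `p 0 = 2` to
  -- -2.
  Z₀ := {cs.simple ⟨0, by omega⟩ * cs.simple ⟨1, by omega⟩}
  φ := D.rep cs
  p k := k + 2
  one_le := by omega
  K_zero := by ext i; simp [mem_initialSet]
  K_top := by ext i; simp [mem_initialSet]; omega
  K_succ k hk := by ext i; simp [mem_initialSet, Fin.ext_iff]; omega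
  comm k hk i hi := by
    simp only [mem_initialSet, true_and] at hi
    refine cs.commute_of_eq_two ?_
    rw [coxeterMatrix_D, if_neg (by simp only [Fin.ext_iff]; omega), if_neg (by simp only; omega)]
  braid k hk := by
    refine cs.braid_of_eq_three ?_
    rw [coxeterMatrix_D, if_neg (by simp only [Fin.ext_iff]; omega), if_pos (by simp only; omega)]
  one_mem_Y₀ := by simp
  Y₀_subset y hy := by
    have h0 : cs.simple ⟨0, by omega⟩ ∈ cs.parabolic (D.initialSet n (0 + 1 + 1)) :=
      cs.simple_mem_parabolic (by simp [mem_initialSet])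
    have h1 : cs.simple ⟨1, by omega⟩ ∈ cs.parabolic (D.initialSet n (0 + 1 + 1)) :=
      cs.simple_mem_parabolic (by simp [mem_initialSet])
    simp only [Finset.mem_insert, Finset.mem_singleton] at hy
    rcases hy with rfl | rfl | rfl | rfl
    exacts [one_mem _, h0, h1, mul_mem h0 h1]
  Y₀_ne := ⟨cs.simple ⟨0, by omega⟩, by simp, fun h ↦ by
    have := cs.length_simple ⟨0, by omega⟩
    rw [h, cs.length_one] at this
    omega⟩
  Y₀_closed i hi y hy := by
    have hc := (simple_commute_fork hn cs).eq
    have hi : i = ⟨0, by omega⟩ ∨ i = ⟨1, by omega⟩ := by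
      rw [mem_initialSet] at hi
      simp only [Fin.ext_iff]; omega
    simp only [Finset.mem_insert, Finset.mem_singleton] at hy
    rcases hi with rfl | rfl <;> rcases hy with rfl | rfl | rfl | rfl <;> simp [← hc]
    rw [hc]; simp
  Z₀_subset := by simp
  Z₀_subsingleton := by simp
  Z₀_sq z hz := by
    obtain rfl := Finset.mem_singleton.1 hz
    nth_rw 2 [(simple_commute_fork hn cs).eq]
    simp [← mul_assoc]
  Y₀_step hN y hy := by
    simp only [Finset.mem_insert, Finset.mem_singleton] at hy
    rcases hy with rfl | rfl | rfl | rfl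
    · exact .inl rfl
    · refine .inr (.inr ⟨_, by simp [mem_initialSet], rfl, ?_⟩)
      exact (simple_braid_fork cs (by simp) (by simp only; omega)).symm
    · refine .inr (.inr ⟨_, by simp [mem_initialSet], rfl, ?_⟩)
      exact (simple_braid_fork cs (by simp) (by simp only; omega)).symm
    · exact .inr (.inl (Finset.mem_singleton_self _))
  Z₀_step hN z hz i hi := by
    obtain rfl := Finset.mem_singleton.1 hz
    have hi : i = ⟨0, by omega⟩ ∨ i = ⟨1, by omega⟩ := by
      rw [mem_initialSet] at hi
      simp only [Fin.ext_iff]; omega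
    rcases hi with rfl | rfl
    · refine ⟨⟨1, by omega⟩, by simp [mem_initialSet], fork_swap ?_ ?_⟩ <;>
        exact simple_braid_fork cs (by simp) (by simp only; omega)
    · refine ⟨⟨0, by omega⟩, by simp [mem_initialSet], ?_⟩
      rw [(simple_commute_fork hn cs).eq]
      apply fork_swap <;> exact simple_braid_fork cs (by simp) (by simp only; omega)
  Z₀_comm hN z hz := by
    obtain rfl := Finset.mem_singleton.1 hz
    have hc := (simple_commute_fork hn cs).eq
    have h0 : ∀ {k : Fin n}, (k : ℕ) = 2 → _ := fun hk ↦
      simple_braid_fork cs (i := ⟨0, by omega⟩) (by simp) hk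
    have h1 : ∀ {k : Fin n}, (k : ℕ) = 2 → _ := fun hk ↦
      simple_braid_fork cs (i := ⟨1, by omega⟩) (by simp) hk
    have hk : ((⟨min (0 + 2) (n - 1), by omega⟩ : Fin n) : ℕ) = 2 := by simp only; omega
    -- The conjugate exchanges the two fork reflections; as these commute, it commutes with their
    -- product.
    have e0 := fork_swap (h0 hk) (h1 hk)
    have e1 := fork_swap (h1 hk) (h0 hk)
    rw [← hc] at e1
    symm
    change _ = _
    rw [mul_assoc (cs.simple ⟨0, _⟩) (cs.simple ⟨1, _⟩), e1, ← mul_assoc (cs.simple ⟨0, _⟩), e0,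
      mul_assoc _ (cs.simple ⟨1, _⟩), ← hc]
  p_pos := by norm_num
  p_lt k := by push_cast; omega
  p_fixed k hk i hi := by
    simp only [mem_initialSet, true_and] at hi
    obtain ⟨_ | i, hi'⟩ := i <;>
      simp only [rep_simple, signedPerm, swapPair, signedSwap.apply] at hi ⊢ <;> grind
  p_succ k hk := by
    rw [rep_simple]
    simp only [show min (k + 2) (n - 1) = k + 2 by omega]
    simp only [signedPerm, swapPair, signedSwap.apply]; grind
  p_neg k hk := by
    rw [rep_simple]
    simp only [show min (k + 2) (n - 1) = k + 2 by omega]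
    simp only [signedPerm, swapPair, signedSwap.apply]; grind
  Y₀_inj y hy y' hy' h := by
    simp only [Finset.mem_insert, Finset.mem_singleton] at hy hy'
    rcases hy with rfl | rfl | rfl | rfl <;> rcases hy' with rfl | rfl | rfl | rfl <;>
      simp [signedPerm, swapPair, signedSwap.apply, Function.End.one_def, signedSwap.mul_apply] at h ⊢
  Y₀_le y hy := by
    simp only [Finset.mem_insert, Finset.mem_singleton] at hy
    rcases hy with rfl | rfl | rfl | rfl <;>
      simp [signedPerm, swapPair, signedSwap.apply, Function.End.one_def, signedSwap.mul_apply]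
  Z₀_neg z hz := by
    obtain rfl := Finset.mem_singleton.1 hz
    simp [signedPerm, swapPair, signedSwap.apply, signedSwap.mul_apply]

end D

/-! ### From towers to left-connected subgroups -/

/-- The classical Coxeter systems have a tower of parabolic subgroups whose terms are the
left-connected ones. -/
theorem exists_ladder (T : ClassicalType) (n : ℕ) (hn : T.minRank ≤ n)
    (cs : CoxeterSystem (T.coxeterMatrix n) W) : ∃ (N : ℕ) (L : cs.Ladder N),
      L.K (N - 1) = T.initialSet n (n - 1) ∧ ∀ J : Set (Fin n),
        T.IsLeftConnected n cs (cs.parabolic J) ↔ ∃ k ≤ N, J = L.K k := by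
  -- Because a parabolic subgroup determines its generating set, left-connectedness of `W_J` becomes
  -- a condition on `J` itself.
  have hJ : ∀ J, T.IsLeftConnected n cs (cs.parabolic J) ↔
      ∃ j ≤ n, (T = D → 1 ≤ j) ∧ J = T.initialSet n j := fun J ↦ by
    simp only [IsLeftConnected, (T.parabolic_injective cs).eq_iff]
  simp only [hJ]
  cases T with
  | A => exact ⟨n, ladderA hn cs, rfl, fun J ↦ by simp [ladderA]⟩
  | B => exact ⟨n, ladderB hn cs, rfl, fun J ↦ by simp [ladderB]⟩
  | D =>
    have hn : 3 ≤ n := hn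
    refine ⟨n - 1, ladderD hn cs, ?_, fun J ↦ ⟨?_, ?_⟩⟩
    · simp only [ladderD]
      rw [Nat.sub_add_cancel (by omega)]
    · rintro ⟨j, hj, h1, rfl⟩
      have h1 := h1 rfl
      refine ⟨j - 1, by omega, ?_⟩
      simp only [ladderD]
      rw [Nat.sub_add_cancel h1]
    · rintro ⟨k, hk, rfl⟩
      exact ⟨k + 1, by omega, fun _ ↦ by omega, rfl⟩

end ClassicalType

theorem mainTheorem2 (T : ClassicalType) (n : ℕ) (hn : T.minRank ≤ n)
    {W : Type*} [Group W] [Fintype W] (cs : CoxeterSystem (T.coxeterMatrix n) W) :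
    cs.IsNativeBasis (T.algE n cs)
      (cs.descentElt '' {J : Set (Fin n) | T.IsLeftConnected n cs (cs.parabolic J)}) ∧
    Set.InjOn cs.descentElt {J : Set (Fin n) | T.IsLeftConnected n cs (cs.parabolic J)} ∧
    ∀ J : Set (Fin n), T.IsLeftConnected n cs (cs.parabolic J) →
      ∃ p : Polynomial ℤ,
        cs.descentElt J =
          Polynomial.aeval (T.xElt n cs (n - 1)) (p.map (Int.castRingHom ℚ)) := by
  obtain ⟨N, L, h, hJ⟩ := T.exists_ladder n hn cs
  simp only [hJ, ClassicalType.algE, ClassicalType.xElt, ← h]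
  refine ⟨L.isNativeBasis, L.injOn, ?_⟩
  rintro _ ⟨k, hk, rfl⟩
  exact L.exists_polynomial k hk
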